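/- Let $q\in[0,1)$ and $0<\kappa_1\le\kappa_2$. For $s,M>0$ and a dimension $p$, let $\mathcal U_q(s,M)$ be the set of positive definite $W\in\mathbb R^{p\times p}$ with $\max_j\sum_i|w_{ij}|^q\le s$ (with $0^0=0$) and $\max_j\sum_i|w_{ij}|\le M$. For a symmetric matrix $S\in\mathbb R^{p\times p}$ and $\lambda\ge0$, a SCIO estimate computed from $S$ with parameter $\lambda$ is a symmetric matrix $\tilde\Omega$ whose $(i,j)$ entry is whichever of $\hat\Omega_{ij},\hat\Omega_{ji}$ has the smaller absolute value, where the $i$-th column of $\hat\Omega$ minimizes $\tfrac12\beta^\top S\beta-e_i^\top\beta+\lambda|\beta|_1$ over $\beta\in\mathbb R^p$. Consider a sequence of models (the index is suppressed) with positive integers $m,f,n$. Let $A\in\mathbb R^{m\times m}$ and $B\in\mathbb R^{f\times f}$ be positive definite correlation matrices (unit diagonal) all of whose eigenvalues lie in $[\kappa_1,\kappa_2]$, and let $X(1),\dots,X(n)\in\mathbb R^{f\times m}$ be i.i.d. with $\operatorname{vec}(X(t))\sim\mathcal N(0,A\otimes B)$. Suppose that $A^{-1}\in\mathcal U_q(s_m,M_m)$,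 $B^{-1}\in\mathcal U_q(\tilde s_f,\tilde M_f)$ and, along the sequence, $$\delta_A:=s_mM_m^{2-2q}\Big(\frac{\log(m\vee f)}{nf}\Big)^{\frac{1-q}2}\to0,\qquad \delta_B:=\tilde s_f\tilde M_f^{2-2q}\Big(\frac{\log(m\vee f)}{nm}\Big)^{\frac{1-q}2}\to0 .$$ Let $x(t)^1,\dots,x(t)^m\in\mathbb R^f$ be the columns of $X(t)$, let $$(\hat\Sigma_A)_{ij}=\frac{\sum_{t}(x(t)^i)^\top x(t)^j}{\sqrt{\sum_t (x(t)^i)^\top x(t)^i}\,\sqrt{\sum_t (x(t)^j)^\top x(t)^j}},$$ and let $\hat\Sigma_B$ be defined in the same way from the rows of the $X(t)$ (the Gemini estimators). Put $$\lambda_A=C_AM_m\sqrt{\frac{\log(m\vee f)}{nf}},\qquad \lambda_B=C_B\tilde M_f\sqrt{\frac{\log(m\vee f)}{nm}} .$$ There is a constant $C_0>0$ depending only on $q,\kappa_1,\kappa_2$ such that for all $C_A,C_B\ge C_0$ there are constants $C,D>0$ depending only on $q,\kappa_1,\kappa_2,C_A,C_B$ with the following property. For every such sequence, at all sufficiently large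 indices, with probability at least $1-D(m\vee f)^{-2}$, SCIO estimates computed from $\hat\Sigma_A$ with $\lambda_A$ and from $\hat\Sigma_B$ with $\lambda_B$ exist, and for all such estimates $\tilde\Omega_A,\tilde\Omega_B$ the matrix $\tilde\Omega_4=\tilde\Omega_A\otimes\tilde\Omega_B$ satisfies $$\big\|\tilde\Omega_4-(A\otimes B)^{-1}\big\|_2\le C\left(s_mM_m^{2-2q}\Big(\frac{\log(m\vee f)}{nf}\Big)^{\frac{1-q}2}+\tilde s_f\tilde M_f^{2-2q}\Big(\frac{\log(m\vee f)}{nm}\Big)^{\frac{1-q}2}\right)$$ in spectral norm. -/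

import Mathlib

open MeasureTheory ProbabilityTheory Filter Topology Matrix
open scoped Kronecker

/-- `|x|^q` with the usual convention `0^0 = 0` of `ℓ_q` sparsity, so that for `q = 0` the sum of
these terms counts the nonzero entries. -/
noncomputable def absPow (q x : ℝ) : ℝ := if x = 0 then 0 else |x| ^ q

/-- The sparsity class `U_q(s, M)`: positive definite matrices all of whose columns satisfy
`∑ i, |ω i j|^q ≤ s`, and whose matrix `ℓ₁` norm (maximal absolute column sum) is at most `M`. -/
def SparseClass {ι : Type*} [Fintype ι] (q s M : ℝ) (W : Matrix ι ι ℝ) : Prop :=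
  W.PosDef ∧ (∀ j, ∑ i, absPow q (W i j) ≤ s) ∧ (∀ j, ∑ i, |W i j| ≤ M)

/-- Spectral norm: the operator norm with respect to the Euclidean norm. -/
noncomputable def specNorm {ι : Type*} [Fintype ι] [DecidableEq ι] (W : Matrix ι ι ℝ) : ℝ :=
  ‖Matrix.toEuclideanCLM (n := ι) (𝕜 := ℝ) W‖

/-- The SCIO objective of column `i`: `½ βᵀ S β - e_iᵀ β + lam |β|₁`. -/
noncomputable def scioLoss {ι : Type*} [Fintype ι] (S : Matrix ι ι ℝ) (lam : ℝ) (i : ι)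
    (b : ι → ℝ) : ℝ :=
  1 / 2 * (b ⬝ᵥ (S *ᵥ b)) - b i + lam * ∑ j, |b j|

/-- `W` is an unsymmetrized SCIO solution: each column `W_i` minimizes the objective over all
vectors. -/
def IsScioColumns {ι : Type*} [Fintype ι] (S : Matrix ι ι ℝ) (lam : ℝ) (W : Matrix ι ι ℝ) :
    Prop :=
  ∀ i, ∀ b : ι → ℝ, scioLoss S lam i (fun j => W j i) ≤ scioLoss S lam i b

/-- `V` is the symmetrization of `W`: it is symmetric and its `(i,j)` entry is whichever of `W i j`
and `W j i` is smaller in absolute value (any choice is allowed in case of a tie). -/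
def IsMinSymmetrization {ι : Type*} (W V : Matrix ι ι ℝ) : Prop :=
  V.IsSymm ∧ ∀ i j, (V i j = W i j ∧ |W i j| ≤ |W j i|) ∨ (V i j = W j i ∧ |W j i| ≤ |W i j|)

/-- `V` is a (final, symmetric) SCIO estimate computed from the pilot estimate `S`. -/
def IsScio {ι : Type*} [Fintype ι] (S : Matrix ι ι ℝ) (lam : ℝ) (V : Matrix ι ι ℝ) : Prop :=
  ∃ W, IsScioColumns S lam W ∧ IsMinSymmetrization W V

/-- The Gemini pilot estimator of the column covariance `A` from matrices `x 1, …, x n` of size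
`f × m`: sample correlations of the columns. -/
noncomputable def geminiA {n f m : ℕ} (x : Fin n → Matrix (Fin f) (Fin m) ℝ) :
    Matrix (Fin m) (Fin m) ℝ :=
  Matrix.of fun i j =>
    (∑ t, ∑ l, x t l i * x t l j) /
      (√(∑ t, ∑ l, x t l i * x t l i) * √(∑ t, ∑ l, x t l j * x t l j))

/-- The Gemini pilot estimator of the row covariance `B`: sample correlations of the rows. -/
noncomputable def geminiB {n f m : ℕ} (x : Fin n → Matrix (Fin f) (Fin m) ℝ) :
    Matrix (Fin f) (Fin f) ℝ :=
  geminiA fun t => (x t)ᵀ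

/-- Correlation matrices: positive definite with unit diagonal. -/
def IsCorrelation {ι : Type*} [Fintype ι] (A : Matrix ι ι ℝ) : Prop :=
  A.PosDef ∧ ∀ i, A i i = 1

/-- `X 1, …, X n` are independent random `f × m` matrices with
`vec (X t) ∼ N(0, A ⊗ B)`, where `vec` stacks the columns. -/
def IsMatrixNormalSample {Ω : Type*} [MeasurableSpace Ω] (P : Measure Ω) {n f m : ℕ}
    (A : Matrix (Fin m) (Fin m) ℝ) (B : Matrix (Fin f) (Fin f) ℝ)
    (X : Fin n → Ω → Matrix (Fin f) (Fin m) ℝ) : Prop :=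
  (∀ t, HasLaw (fun ω => WithLp.toLp 2 (Matrix.vec (X t ω)))
    (multivariateGaussian 0 (A ⊗ₖ B)) P) ∧
  iIndepFun (fun t ω => WithLp.toLp 2 (Matrix.vec (X t ω))) P

/-- `log (m ∨ f) / (n d)`. -/
noncomputable def logRatio (m f n d : ℕ) : ℝ :=
  Real.log (max m f : ℕ) / ((n : ℝ) * (d : ℝ))

/-- `s M^{2-2q} (log (m ∨ f) / (n d))^{(1-q)/2}`. -/
noncomputable def scioRate (q s M : ℝ) (m f n d : ℕ) : ℝ :=
  s * M ^ (2 - 2 * q) * logRatio m f n d ^ ((1 - q) / 2)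

/-- The data `x` are such that SCIO estimates of `A⁻¹` (from `geminiA x`) and of `B⁻¹` (from
`geminiB x`) exist, and the Kronecker product of any two of them is within `r` of `(A ⊗ B)⁻¹` in
spectral norm. -/
def ScioKroneckerWithin {n f m : ℕ} (A : Matrix (Fin m) (Fin m) ℝ) (B : Matrix (Fin f) (Fin f) ℝ)
    (lamA lamB r : ℝ) (x : Fin n → Matrix (Fin f) (Fin m) ℝ) : Prop :=
  (∃ V, IsScio (geminiA x) lamA V) ∧ (∃ V, IsScio (geminiB x) lamB V) ∧
  ∀ VA VB, IsScio (geminiA x) lamA VA → IsScio (geminiB x) lamB VB →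
    specNorm (VA ⊗ₖ VB - (A ⊗ₖ B)⁻¹) ≤ r

/-! Probability enters only through the event that the average products of columns (and of rows) are
uniformly close to `A` (and `B`); the rest is deterministic. For fixed u the vector X(t)u is centred
Gaussian with covariance (uᵀAu)B. In the eigenbasis of B its coordinates are independent, so
|X(t)u|² is a weighted sum of independent chi-squares and a Chernoff bound applies
(`IsKroneckerSample.quadratic_tail`). Taking u = eᵢ ± eⱼ, polarising and applying a union bound
controls all entries at scale r = √(log(m∨f)/(nf)) (`IsKroneckerSample.columnGram_tail`).
Normalising to correlations costs a constant factor, so the pilot S satisfies |S - A| ≤ ρ entrywise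
with ρ of order r.

Write Θ = A⁻¹. Its columns are λ/2-feasible, since SΘ - 1 = (S - A)Θ has entries at most ρM. A
lasso-type argument then bounds the ℓ₁ error of each column by a multiple of sλ^(1-q); strong
convexity is inherited from A because ρsλ^(-q) is small. The optimality condition gives an entrywise
error of order Mλ. Minimum symmetrization may import entries from other columns, whose ℓ₁ errors are
not controlled column by column. Splitting Θ at the level Mλ repairs this: large entries are few and
have small entrywise error, and on small ones the symmetrized entry is dominated by that of the
original column. The total is of order s(Mλ)^(1-q), which is the stated rate, and it bounds the
spectral norm of a symmetric matrix (`exists_isScio_and_specNorm_sub_inv_le`). A telescoping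
identity and multiplicativity of the norm combine the two Kronecker factors. -/

section SquareMgf

/-! ### Moment generating functions of squared Gaussians -/

lemma neg_log_one_sub_le {y : ℝ} (hy : |y| ≤ 1 / 2) : -Real.log (1 - y) ≤ y + 2 * y ^ 2 := by
  have h := Real.abs_log_sub_add_sum_range_le (x := y) (by linarith) 1
  simp only [Finset.sum_range_one, Nat.cast_zero, zero_add, pow_one, div_one] at h
  have h2 : |y| ^ (1 + 1) / (1 - |y|) ≤ 2 * y ^ 2 := by
    rw [div_le_iff₀ (by linarith), ← sq_abs y, one_add_one_eq_two]
    nlinarith [mul_nonneg (sq_nonneg |y|) (sub_nonneg.mpr hy)]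
  linarith [(abs_le.mp h).1]

lemma integrable_exp_sq_gaussianReal_and_integral_le (v : NNReal) {θ : ℝ}
    (h : |θ| * v ≤ 1 / 4) :
    Integrable (fun x => Real.exp (θ * x ^ 2)) (gaussianReal 0 v) ∧
      ∫ x, Real.exp (θ * x ^ 2) ∂(gaussianReal 0 v) ≤ Real.exp (θ * v + 4 * (θ * v) ^ 2) := by
  rcases eq_or_ne v 0 with rfl | hv
  · simp [integrable_dirac]
  have hv0 : (0 : ℝ) < v := by positivity
  have habs : |2 * θ * v| ≤ 1 / 2 := by
    rw [abs_mul, abs_mul, abs_of_pos hv0, abs_two]; linarith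
  have hy := abs_le.mp habs
  set b : ℝ := (1 - 2 * θ * v) / (2 * v) with hb
  have hb0 : 0 < b := by apply div_pos <;> linarith
  have heq : ∀ x : ℝ, gaussianPDFReal 0 v x * Real.exp (θ * x ^ 2)
      = (√(2 * Real.pi * v))⁻¹ * Real.exp (-b * x ^ 2) := by
    intro x
    rw [gaussianPDFReal, mul_assoc, ← Real.exp_add, hb]
    congr 2
    field_simp
    ring
  constructor
  · rw [gaussianReal_of_var_ne_zero _ hv, integrable_withDensity_iff_integrable_smul']
    · simp only [toReal_gaussianPDF, smul_eq_mul, heq]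
      exact (integrable_exp_neg_mul_sq hb0).const_mul _
    · fun_prop
    · exact ae_of_all _ fun x => gaussianPDF_lt_top
  · rw [integral_gaussianReal_eq_integral_smul hv]
    simp only [smul_eq_mul, heq]
    rw [integral_const_mul, integral_gaussian, ← Real.sqrt_inv, ← Real.sqrt_mul (by positivity)]
    have : (2 * Real.pi * (v : ℝ))⁻¹ * (Real.pi / b) = (1 - 2 * θ * v)⁻¹ := by
      rw [hb]
      have : 1 - 2 * θ * v ≠ 0 := by linarith
      field_simp
    rw [this]
    have hpos : 0 < 1 - 2 * θ * v := by linarith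
    -- Squaring the bound on (1 - 2θv)^(-1/2) leaves -log(1 - y) ≤ y + 2y² at y = 2θv, whose right
    -- side is exactly 2(θv + 4(θv)²).
    rw [Real.sqrt_le_left (Real.exp_pos _).le, ← Real.exp_nat_mul, ← Real.exp_log (inv_pos.mpr hpos),
      Real.log_inv, Real.exp_le_exp]
    have := neg_log_one_sub_le habs
    push_cast
    nlinarith

variable {Ω : Type*} [MeasurableSpace Ω] {P : Measure Ω}

lemma integrable_and_mgf_sum_le {ι : Type*} [Fintype ι] {Y : ι → Ω → ℝ} {θ : ℝ} {b : ι → ℝ}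
    (hind : iIndepFun Y P) (hm : ∀ i, AEMeasurable (Y i) P)
    (hint : ∀ i, Integrable (fun ω => Real.exp (θ * Y i ω)) P)
    (hle : ∀ i, mgf (Y i) P θ ≤ Real.exp (b i)) :
    Integrable (fun ω => Real.exp (θ * ∑ i, Y i ω)) P ∧
      mgf (fun ω => ∑ i, Y i ω) P θ ≤ Real.exp (∑ i, b i) := by
  have := hind.isProbabilityMeasure
  have hsum : (fun ω => ∑ i, Y i ω) = ∑ i, Y i := by ext ω; simp
  have hmgf : mgf (fun ω => ∑ i, Y i ω) P θ = ∏ i, mgf (Y i) P θ := by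
    rw [hsum, hind.mgf_sum₀ hm]
  constructor
  -- A nonintegrable exponential would give `mgf` its default value 0, but the product of the
  -- factors is positive.
  · by_contra hcon
    have h0 := mgf_undef hcon
    rw [hmgf] at h0
    exact (Finset.prod_pos fun i _ => mgf_pos (hint i)).ne' h0
  · rw [hmgf, Real.exp_sum]
    exact Finset.prod_le_prod (fun i _ => mgf_nonneg) fun i _ => hle i

lemma integrable_and_mgf_sum_sq_le {ι : Type*} [Fintype ι] {ξ : ι → Ω → ℝ} {θ : ℝ} {v : ι → ℝ}
    (hξ : HasGaussianLaw (fun ω i => ξ i ω) P) (hmean : ∀ i, P[ξ i] = 0)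
    (hcov : ∀ i j, i ≠ j → cov[ξ i, ξ j; P] = 0) (hvar : ∀ i, cov[ξ i, ξ i; P] = v i)
    (hθ : ∀ i, |θ| * v i ≤ 1 / 4) :
    Integrable (fun ω => Real.exp (θ * ∑ i, ξ i ω ^ 2)) P ∧
      mgf (fun ω => ∑ i, ξ i ω ^ 2) P θ ≤ Real.exp (∑ i, (θ * v i + 4 * (θ * v i) ^ 2)) := by
  have hind := hξ.iIndepFun_of_covariance_eq_zero hcov
  have hm : ∀ i, AEMeasurable (ξ i) P := fun i => (hξ.eval i).aemeasurable
  have hmap : ∀ i, P.map (ξ i) = gaussianReal 0 (v i).toNNReal := by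
    intro i
    rw [(hξ.eval i).map_eq_gaussianReal, hmean, ← covariance_self (hm i), hvar]
  have hv0 : ∀ i, 0 ≤ v i := fun i => by
    rw [← hvar, covariance_self (hm i)]; exact variance_nonneg _ _
  have hb : ∀ i, Integrable (fun x => Real.exp (θ * x ^ 2)) (P.map (ξ i)) ∧
      ∫ x, Real.exp (θ * x ^ 2) ∂(P.map (ξ i)) ≤ Real.exp (θ * v i + 4 * (θ * v i) ^ 2) := by
    intro i
    have := integrable_exp_sq_gaussianReal_and_integral_le (v i).toNNReal (θ := θ)
    rw [Real.coe_toNNReal _ (hv0 i)] at this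
    rw [hmap]
    exact this (hθ i)
  refine integrable_and_mgf_sum_le (Y := fun i ω => ξ i ω ^ 2)
    (hind.comp (fun _ x => x ^ 2) fun _ => by fun_prop) (fun i => (hm i).pow_const 2) ?_ ?_
  · intro i
    exact (integrable_map_measure (by fun_prop) (hm i)).mp (hb i).1
  · intro i
    have := (hb i).2
    rwa [integral_map (hm i) (by fun_prop)] at this

end SquareMgf

/-! ### Quadratic forms of matrix-normal data -/

section QuadraticForm

variable {Ω : Type*} [MeasurableSpace Ω] {P : Measure Ω}

/-- The entries of the independent random matrices `X 1, …, X n` are jointly Gaussian, centred and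
have covariances `Cov (X_{li}, X_{kj}) = A i j * B l k`. -/
structure IsKroneckerSample (P : Measure Ω) {n f m : ℕ}
    (A : Matrix (Fin m) (Fin m) ℝ) (B : Matrix (Fin f) (Fin f) ℝ)
    (X : Fin n → Ω → Matrix (Fin f) (Fin m) ℝ) : Prop where
  gaussian : ∀ t, HasGaussianLaw (fun ω (p : Fin m × Fin f) => X t ω p.2 p.1) P
  mean : ∀ t l i, P[fun ω => X t ω l i] = 0
  cov : ∀ t l k i j, cov[fun ω => X t ω l i, fun ω => X t ω k j; P] = A i j * B l k
  indep : iIndepFun (fun t ω (p : Fin m × Fin f) => X t ω p.2 p.1) P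

variable {n f m : ℕ} {A : Matrix (Fin m) (Fin m) ℝ} {B : Matrix (Fin f) (Fin f) ℝ}
  {X : Fin n → Ω → Matrix (Fin f) (Fin m) ℝ}

/-- Exchanges the roles of the two factors, so that only columns need a concentration bound. -/
lemma IsKroneckerSample.transpose (h : IsKroneckerSample P A B X) :
    IsKroneckerSample P B A (fun t ω => (X t ω)ᵀ) where
  gaussian t := by
    let L : (Fin m × Fin f → ℝ) →L[ℝ] (Fin f × Fin m → ℝ) :=
      ContinuousLinearMap.pi fun p => ContinuousLinearMap.proj p.swap
    exact (h.gaussian t).map_fun L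
  mean t l i := h.mean t i l
  cov t l k i j := by
    simp only [transpose_apply]
    rw [h.cov, mul_comm]
  indep := h.indep.comp (fun _ x (p : Fin f × Fin m) => x p.swap) fun _ => by fun_prop

lemma IsMatrixNormalSample.isKroneckerSample (h : IsMatrixNormalSample P A B X)
    (hA : A.PosSemidef) (hB : B.PosSemidef) : IsKroneckerSample P A B X where
  gaussian t := by
    let L := (PiLp.continuousLinearEquiv 2 ℝ (fun _ : Fin m × Fin f => ℝ)).toContinuousLinearMap
    exact (h.1 t).hasGaussianLaw.map_fun L
  mean t l i := by
    have h1 := (h.1 t).integral_comp (f := fun x => x (i, l)) (by fun_prop)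
    have h2 := (EuclideanSpace.proj (𝕜 := ℝ) (i, l)).integral_comp_id_comm
      (μ := multivariateGaussian 0 (A ⊗ₖ B)) IsGaussian.integrable_id
    simp only [integral_id_multivariateGaussian, map_zero] at h2
    exact h1.trans h2
  cov t l k i j := by
    have h1 := (h.1 t).covariance_fun_comp (f := fun x => x (i, l)) (g := fun x => x (j, k))
      (by fun_prop) (by fun_prop)
    rw [covariance_eval_multivariateGaussian (hA.kronecker hB)] at h1
    exact h1
  indep := h.2.comp (fun _ x => WithLp.ofLp x) fun _ => by fun_prop

lemma covariance_sum_mul {ι : Type*} [Fintype ι] {Y : ι → Ω → ℝ} [IsFiniteMeasure P]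
    (hY : ∀ i, MemLp (Y i) 2 P) (c d : ι → ℝ) :
    cov[fun ω => ∑ i, c i * Y i ω, fun ω => ∑ i, d i * Y i ω; P] =
      ∑ i, ∑ j, c i * d j * cov[Y i, Y j; P] := by
  rw [covariance_fun_sum_fun_sum (fun i => (hY i).const_mul _) (fun i => (hY i).const_mul _)]
  refine Finset.sum_congr rfl fun i _ => Finset.sum_congr rfl fun j _ => ?_
  rw [covariance_const_mul_left, covariance_const_mul_right]
  ring

lemma sum_sq_dotProduct_eigenvectorBasis (hB : B.IsHermitian) (y : Fin f → ℝ) :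
    ∑ l, (∑ k, hB.eigenvectorBasis l k * y k) ^ 2 = ∑ k, y k ^ 2 := by
  have := hB.eigenvectorBasis.sum_sq_inner_right (WithLp.toLp 2 y)
  rw [EuclideanSpace.real_norm_sq_eq] at this
  rw [← this]
  refine Finset.sum_congr rfl fun l _ => ?_
  rw [PiLp.inner_apply]
  simp [mul_comm]

lemma sum_mul_eigenvectorBasis (hB : B.IsHermitian) (a b : Fin f) :
    ∑ l, ∑ k, hB.eigenvectorBasis a l * hB.eigenvectorBasis b k * B l k =
      if a = b then hB.eigenvalues a else 0 := by
  have h1 : ∀ l, ∑ k, B l k * hB.eigenvectorBasis b k =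
      hB.eigenvalues b * hB.eigenvectorBasis b l := fun l =>
    congrFun (hB.mulVec_eigenvectorBasis b) l
  have h2 := orthonormal_iff_ite.mp hB.eigenvectorBasis.orthonormal a b
  rw [PiLp.inner_apply] at h2
  calc _ = ∑ l, hB.eigenvectorBasis a l * ∑ k, B l k * hB.eigenvectorBasis b k := by
        refine Finset.sum_congr rfl fun l _ => ?_
        rw [Finset.mul_sum]
        exact Finset.sum_congr rfl fun k _ => by ring
    _ = hB.eigenvalues b * ∑ l, hB.eigenvectorBasis a l * hB.eigenvectorBasis b l := by
        simp only [h1, Finset.mul_sum]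
        exact Finset.sum_congr rfl fun k _ => by ring
    _ = _ := by
        simp only [RCLike.inner_apply, conj_trivial] at h2
        rw [show ∑ l, hB.eigenvectorBasis a l * hB.eigenvectorBasis b l = if a = b then 1 else 0 by
          rw [← h2]; exact Finset.sum_congr rfl fun k _ => by ring]
        split_ifs with h
        · simp [h]
        · simp

/-- Rotating X(t)u into the eigenbasis of `B` preserves its norm and makes the coordinates
uncorrelated, hence independent by joint Gaussianity, with variances (uᵀAu) times the eigenvalues.
-/
lemma IsKroneckerSample.integrable_and_mgf_quadratic_le (h : IsKroneckerSample P A B X)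
    (hB : B.IsHermitian) (u : Fin m → ℝ) {θ : ℝ}
    (hθ : ∀ l, |θ| * ((u ⬝ᵥ A *ᵥ u) * hB.eigenvalues l) ≤ 1 / 4) :
    Integrable (fun ω => Real.exp (θ * ∑ t, ∑ l, (∑ i, X t ω l i * u i) ^ 2)) P ∧
      mgf (fun ω => ∑ t, ∑ l, (∑ i, X t ω l i * u i) ^ 2) P θ ≤
        Real.exp (n * ∑ l, (θ * ((u ⬝ᵥ A *ᵥ u) * hB.eigenvalues l) +
          4 * (θ * ((u ⬝ᵥ A *ᵥ u) * hB.eigenvalues l)) ^ 2)) := by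
  have := h.indep.isProbabilityMeasure
  have hmem : ∀ t (p : Fin m × Fin f), MemLp (fun ω => X t ω p.2 p.1) 2 P := fun t p =>
    ((h.gaussian t).eval p).memLp_two
  set c : Fin f → Fin m × Fin f → ℝ := fun l p => hB.eigenvectorBasis l p.2 * u p.1 with hc
  set ξ : Fin n → Fin f → Ω → ℝ := fun t l ω => ∑ p, c l p * X t ω p.2 p.1 with hξ
  have hsq : ∀ t ω, ∑ l, (∑ i, X t ω l i * u i) ^ 2 = ∑ l, ξ t l ω ^ 2 := by
    intro t ω
    rw [← sum_sq_dotProduct_eigenvectorBasis hB fun l => ∑ i, X t ω l i * u i]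
    refine Finset.sum_congr rfl fun l _ => ?_
    congr 1
    simp only [hξ, hc, Fintype.sum_prod_type]
    rw [Finset.sum_comm]
    refine Finset.sum_congr rfl fun k _ => ?_
    rw [Finset.mul_sum]
    exact Finset.sum_congr rfl fun i _ => by ring
  have hgauss : ∀ t, HasGaussianLaw (fun ω l => ξ t l ω) P := by
    intro t
    let L : (Fin m × Fin f → ℝ) →L[ℝ] (Fin f → ℝ) :=
      ContinuousLinearMap.pi fun l => ∑ p, c l p • ContinuousLinearMap.proj p
    have hL : (fun ω l => ξ t l ω) = fun ω => L fun p => X t ω p.2 p.1 := by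
      ext ω l
      simp [L, hξ]
    rw [hL]
    exact (h.gaussian t).map_fun L
  have hmean : ∀ t l, P[ξ t l] = 0 := by
    intro t l
    simp only [hξ]
    rw [integral_finsetSum _ fun p _ => ((hmem t p).integrable one_le_two).const_mul _]
    simp only [integral_const_mul, h.mean, mul_zero, Finset.sum_const_zero]
  have hcov : ∀ t a b, cov[ξ t a, ξ t b; P] =
      (u ⬝ᵥ A *ᵥ u) * if a = b then hB.eigenvalues a else 0 := by
    intro t a b
    simp only [hξ]
    rw [covariance_sum_mul (hmem t), ← sum_mul_eigenvectorBasis hB a b]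
    simp only [h.cov, hc, dotProduct, mulVec, Fintype.sum_prod_type, Finset.sum_mul, Finset.mul_sum]
    rw [Finset.sum_comm]
    refine Finset.sum_congr rfl fun l _ => ?_
    rw [Finset.sum_comm]
    conv_lhs => enter [2, i]; rw [Finset.sum_comm]
    rw [Finset.sum_comm]
    refine Finset.sum_congr rfl fun k _ => ?_
    rw [Finset.sum_comm]
    exact Finset.sum_congr rfl fun i _ => Finset.sum_congr rfl fun j _ => by ring
  have hcol := fun t => integrable_and_mgf_sum_sq_le (v := fun l => (u ⬝ᵥ A *ᵥ u) * hB.eigenvalues l)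
    (hgauss t) (hmean t) (fun a b hab => by rw [hcov, if_neg hab, mul_zero])
    (fun a => by rw [hcov, if_pos rfl]) hθ
  have hmeas : ∀ t, AEMeasurable (fun ω => ∑ l, ξ t l ω ^ 2) P := fun t =>
    Finset.aemeasurable_fun_sum _ fun l _ => ((hgauss t).eval l).aemeasurable.pow_const 2
  have hind : iIndepFun (fun t ω => ∑ l, ξ t l ω ^ 2) P :=
    h.indep.comp (fun _ x => ∑ l, (∑ p, c l p * x p) ^ 2) fun _ => by fun_prop
  have := integrable_and_mgf_sum_le hind hmeas (fun t => (hcol t).1) (fun t => (hcol t).2)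
  simp only [hsq]
  simpa using this

end QuadraticForm

/-! ### Concentration of the Gram matrix and of the sample correlations -/

section Concentration

variable {Ω : Type*} [MeasurableSpace Ω] {P : Measure Ω}
variable {n f m : ℕ} {A : Matrix (Fin m) (Fin m) ℝ} {B : Matrix (Fin f) (Fin f) ℝ}
  {X : Fin n → Ω → Matrix (Fin f) (Fin m) ℝ}

lemma IsCorrelation.symm_apply {ι : Type*} [Fintype ι] {A : Matrix ι ι ℝ} (hA : IsCorrelation A)
    (i j : ι) : A i j = A j i := by
  have := hA.1.isHermitian.apply j i
  simpa using this

lemma dotProduct_mulVec_single_add_single {ι : Type*} [Fintype ι] [DecidableEq ι]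
    (A : Matrix ι ι ℝ) (i j : ι) (c : ℝ) :
    (Pi.single i 1 + Pi.single j c) ⬝ᵥ A *ᵥ (Pi.single i 1 + Pi.single j c) =
      A i i + c * A i j + c * A j i + c ^ 2 * A j j := by
  simp [mulVec_add, add_dotProduct, dotProduct_add, mulVec_single]
  ring

lemma IsCorrelation.abs_le_one {ι : Type*} [Fintype ι] [DecidableEq ι] {A : Matrix ι ι ℝ}
    (hA : IsCorrelation A) (i j : ι) : |A i j| ≤ 1 := by
  have h : ∀ c : ℝ, 0 ≤ A i i + c * A i j + c * A j i + c ^ 2 * A j j := fun c => by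
    rw [← dotProduct_mulVec_single_add_single]
    exact hA.1.posSemidef.dotProduct_mulVec_nonneg (Pi.single i 1 + Pi.single j c)
  have h1 := h 1
  have h2 := h (-1)
  rw [← hA.symm_apply i j, hA.2, hA.2] at h1 h2
  rw [abs_le]
  constructor <;> linarith

lemma IsKroneckerSample.quadratic_tail (h : IsKroneckerSample P A B X) (hB : B.IsHermitian)
    (htr : B.trace = f) (u : Fin m → ℝ) {K t : ℝ} (hK : 0 < K)
    (hK0 : ∀ l, 0 ≤ (u ⬝ᵥ A *ᵥ u) * hB.eigenvalues l)
    (hK1 : ∀ l, (u ⬝ᵥ A *ᵥ u) * hB.eigenvalues l ≤ K) (ht0 : 0 ≤ t) (htK : t ≤ K) :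
    P.real {ω | n * f * t ≤
        |(∑ t, ∑ l, (∑ i, X t ω l i * u i) ^ 2) - n * f * (u ⬝ᵥ A *ᵥ u)|} ≤
      2 * Real.exp (-(n * f * t ^ 2 / (16 * K ^ 2))) := by
  have := h.indep.isProbabilityMeasure
  set τ := u ⬝ᵥ A *ᵥ u
  set Q : Ω → ℝ := fun ω => ∑ t, ∑ l, (∑ i, X t ω l i * u i) ^ 2 with hQ
  have hsum : ∑ l, hB.eigenvalues l = f := by
    rw [← htr, hB.trace_eq_sum_eigenvalues]; simp
  -- The choice |θ| = t/(8K²) minimises -|θ|t + 4θ²K². The trace condition makes the linear term of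
  -- the exponent equal the mean, so it cancels.
  have hmgf : ∀ θ : ℝ, |θ| = t / (8 * K ^ 2) → Integrable (fun ω => Real.exp (θ * Q ω)) P ∧
      mgf Q P θ ≤ Real.exp (n * f * (θ * τ) + n * f * t ^ 2 / (16 * K ^ 2)) := by
    intro θ hθ
    have hb : ∀ l, |θ| * (τ * hB.eigenvalues l) ≤ 1 / 4 := by
      intro l
      calc |θ| * (τ * hB.eigenvalues l) ≤ |θ| * K := by gcongr; exact hK1 l
        _ = t / (8 * K) := by rw [hθ]; field_simp
        _ ≤ 1 / 4 := by rw [div_le_div_iff₀ (by positivity) (by norm_num)]; linarith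
    obtain ⟨h1, h2⟩ := h.integrable_and_mgf_quadratic_le hB u hb
    refine ⟨h1, h2.trans (Real.exp_le_exp.mpr ?_)⟩
    have h4 : ∀ l, 4 * (θ * (τ * hB.eigenvalues l)) ^ 2 ≤ t ^ 2 / (16 * K ^ 2) := by
      intro l
      calc 4 * (θ * (τ * hB.eigenvalues l)) ^ 2 = 4 * (|θ| ^ 2 * (τ * hB.eigenvalues l) ^ 2) := by
            rw [sq_abs]; ring
        _ ≤ 4 * (|θ| ^ 2 * K ^ 2) := by gcongr; exacts [hK0 l, hK1 l]
        _ = t ^ 2 / (16 * K ^ 2) := by rw [hθ]; field_simp; ring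
    calc _ ≤ (n : ℝ) * ∑ l, (θ * (τ * hB.eigenvalues l) + t ^ 2 / (16 * K ^ 2)) := by
          gcongr with l; exact h4 l
      _ = (n : ℝ) * (θ * τ * ∑ l, hB.eigenvalues l + f * (t ^ 2 / (16 * K ^ 2))) := by
          rw [Finset.sum_add_distrib, Finset.mul_sum]
          simp [mul_assoc]
      _ = _ := by rw [hsum]; ring
  have hθ0 : 0 ≤ t / (8 * K ^ 2) := by positivity
  obtain ⟨i1, m1⟩ := hmgf (t / (8 * K ^ 2)) (abs_of_nonneg hθ0)
  obtain ⟨i2, m2⟩ := hmgf (-(t / (8 * K ^ 2))) (by rw [abs_neg, abs_of_nonneg hθ0])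
  have up := measure_ge_le_exp_mul_mgf (n * f * τ + n * f * t) hθ0 i1
  have lo := measure_le_le_exp_mul_mgf (n * f * τ - n * f * t) (neg_nonpos.mpr hθ0) i2
  have up' := up.trans (mul_le_mul_of_nonneg_left m1 (Real.exp_pos _).le)
  have lo' := lo.trans (mul_le_mul_of_nonneg_left m2 (Real.exp_pos _).le)
  rw [← Real.exp_add] at up' lo'
  have e1 : -(t / (8 * K ^ 2)) * (n * f * τ + n * f * t) +
      (n * f * (t / (8 * K ^ 2) * τ) + n * f * t ^ 2 / (16 * K ^ 2)) =
      -(n * f * t ^ 2 / (16 * K ^ 2)) := by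
    field_simp
    ring
  have e2 : - -(t / (8 * K ^ 2)) * (n * f * τ - n * f * t) +
      (n * f * (-(t / (8 * K ^ 2)) * τ) + n * f * t ^ 2 / (16 * K ^ 2)) =
      -(n * f * t ^ 2 / (16 * K ^ 2)) := by
    field_simp
    ring
  rw [e1] at up'
  rw [e2] at lo'
  calc _ ≤ P.real ({ω | n * f * τ + n * f * t ≤ Q ω} ∪ {ω | Q ω ≤ n * f * τ - n * f * t}) := by
        refine measureReal_mono ?_
        intro ω hω
        rw [Set.mem_ofPred_eq] at hω
        rw [Set.mem_union, Set.mem_ofPred_eq, Set.mem_ofPred_eq]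
        rcases le_abs.mp hω with h' | h'
        · left; linarith
        · right; linarith
    _ ≤ _ := (measureReal_union_le _ _).trans (by linarith)

/-- The matrix of average products of the columns of the data. -/
noncomputable def columnGram (x : Fin n → Matrix (Fin f) (Fin m) ℝ) (i j : Fin m) : ℝ :=
  (∑ t, ∑ l, x t l i * x t l j) / (n * f)

lemma IsKroneckerSample.columnGram_tail (h : IsKroneckerSample P A B X) (hA : IsCorrelation A)
    (hB : IsCorrelation B) {κ r L : ℝ} (hκ : 0 < κ) (hBκ : ∀ μ ∈ spectrum ℝ B, μ ≤ κ)
    (hn : 0 < n) (hf : 0 < f) (hr0 : 0 ≤ r) (hr : r ≤ 1 / 8) (hrL : n * f * r ^ 2 = L) :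
    P.real {ω | ∃ i j, 16 * κ * r < |columnGram (fun t => X t ω) i j - A i j|} ≤
      4 * m ^ 2 * Real.exp (-(4 * L)) := by
  have := h.indep.isProbabilityMeasure
  have hBH := hB.1.isHermitian
  have htr : B.trace = f := by simp [Matrix.trace, hB.2]
  have hnf : (0 : ℝ) < n * f := by positivity
  set u : Fin m → Fin m → ℝ → Fin m → ℝ := fun i j c => Pi.single i 1 + Pi.single j c with hu
  set E : Fin m → Fin m → ℝ → Set Ω := fun i j c => {ω | n * f * (32 * κ * r) ≤
    |(∑ t, ∑ l, (∑ k, X t ω l k * u i j c k) ^ 2) - n * f * (u i j c ⬝ᵥ A *ᵥ u i j c)|} with hE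
  have htail : ∀ i j c, |c| = 1 → P.real (E i j c) ≤ 2 * Real.exp (-(4 * L)) := by
    intro i j c hc
    have hc2 : c ^ 2 = 1 := by rw [← sq_abs, hc, one_pow]
    have hτ0 : 0 ≤ u i j c ⬝ᵥ A *ᵥ u i j c := by
      simpa using hA.1.posSemidef.dotProduct_mulVec_nonneg (u i j c)
    have hτ : u i j c ⬝ᵥ A *ᵥ u i j c ≤ 4 := by
      rw [hu, dotProduct_mulVec_single_add_single, ← hA.symm_apply i j, hA.2, hA.2, hc2]
      have : c * A i j ≤ 1 := (le_abs_self _).trans (by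
        rw [abs_mul, hc, one_mul]; exact hA.abs_le_one i j)
      linarith
    have hpos : ∀ l, 0 ≤ hBH.eigenvalues l := fun l => (hB.1.eigenvalues_pos l).le
    have hle : ∀ l, hBH.eigenvalues l ≤ κ := fun l => hBκ _ (hBH.eigenvalues_mem_spectrum_real l)
    -- Polarisation divides the sum of two errors 32κr by 4, leaving 16κr. With K = 4κ the exponent
    -- nft²/(16K²) is 4nfr² = 4L, and r ≤ 1/8 is exactly t ≤ K.
    have := h.quadratic_tail hBH htr (u i j c) (K := 4 * κ) (t := 32 * κ * r) (by positivity)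
      (fun l => mul_nonneg hτ0 (hpos l)) (fun l => mul_le_mul hτ (hle l) (hpos l) (by norm_num))
      (by positivity) (by nlinarith)
    refine this.trans_eq ?_
    rw [← hrL]
    congr 3
    field_simp
    ring
  calc _ ≤ P.real (⋃ i, ⋃ j, (E i j 1 ∪ E i j (-1))) := by
        refine measureReal_mono ?_
        rintro ω ⟨i, j, hij⟩
        simp only [Set.mem_iUnion]
        refine ⟨i, j, ?_⟩
        by_contra hcon
        rw [Set.mem_union, not_or, hE, Set.mem_ofPred_eq, Set.mem_ofPred_eq, not_le, not_le] at hcon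
        obtain ⟨h1, h2⟩ := hcon
        have hpol : ∀ c : ℝ, ∑ t, ∑ l, (∑ k, X t ω l k * u i j c k) ^ 2 =
            (∑ t, ∑ l, X t ω l i ^ 2) + 2 * c * (∑ t, ∑ l, X t ω l i * X t ω l j) +
              c ^ 2 * ∑ t, ∑ l, X t ω l j ^ 2 := by
          intro c
          simp only [Finset.mul_sum, ← Finset.sum_add_distrib]
          refine Finset.sum_congr rfl fun t _ => Finset.sum_congr rfl fun l _ => ?_
          have : ∑ k, X t ω l k * u i j c k = X t ω l i + c * X t ω l j := by
            simp [hu, mul_add, Finset.sum_add_distrib, Pi.single_apply, mul_comm]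
          rw [this]
          ring
        simp only [hpol] at h1 h2
        rw [hu, dotProduct_mulVec_single_add_single, ← hA.symm_apply i j] at h1 h2
        have hG : ∑ t, ∑ l, X t ω l i * X t ω l j =
            n * f * columnGram (fun t => X t ω) i j := by
          rw [columnGram]; field_simp
        rw [hG, abs_lt] at h1 h2
        refine absurd hij (not_lt.mpr (abs_le.mpr ⟨?_, ?_⟩)) <;>
          refine le_of_mul_le_mul_left ?_ hnf <;> linarith [h1.1, h1.2, h2.1, h2.2]
    _ ≤ ∑ i, ∑ j, P.real (E i j 1 ∪ E i j (-1)) :=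
        (measureReal_iUnion_fintype_le _).trans
          (Finset.sum_le_sum fun i _ => measureReal_iUnion_fintype_le _)
    _ ≤ ∑ i : Fin m, ∑ j : Fin m, 4 * Real.exp (-(4 * L)) := by
        gcongr with i _ j _
        refine (measureReal_union_le _ _).trans ?_
        linarith [htail i j 1 (by simp), htail i j (-1) (by simp)]
    _ = _ := by
        simp only [Finset.sum_const, Finset.card_univ, Fintype.card_fin, nsmul_eq_mul]
        ring

lemma geminiA_eq_columnGram (hn : 0 < n) (hf : 0 < f) (x : Fin n → Matrix (Fin f) (Fin m) ℝ)
    (i j : Fin m) :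
    geminiA x i j = columnGram x i j / (√(columnGram x i i) * √(columnGram x j j)) := by
  have hnf : (0 : ℝ) < n * f := by positivity
  have h1 : ∀ i, √(columnGram x i i) = √(∑ t, ∑ l, x t l i * x t l i) / √(n * f) := fun i => by
    rw [columnGram, Real.sqrt_div' _ hnf.le]
  rw [h1, h1, columnGram, div_mul_div_comm, Real.mul_self_sqrt hnf.le,
    div_div_div_cancel_right₀ hnf.ne']
  rfl

/-- The normalising product w lies in [1 - d, 1 + d], so the error is at most 2d/w, and w ≥ 1/2. -/
lemma abs_geminiA_sub_le (hn : 0 < n) (hf : 0 < f) (hA : IsCorrelation A)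
    {x : Fin n → Matrix (Fin f) (Fin m) ℝ} {d : ℝ} (hd : d ≤ 1 / 2)
    (h : ∀ i j, |columnGram x i j - A i j| ≤ d) (i j : Fin m) :
    |geminiA x i j - A i j| ≤ 4 * d := by
  have hd0 : 0 ≤ d := (abs_nonneg _).trans (h i j)
  have hdiag : ∀ i, |columnGram x i i - 1| ≤ d := fun i => by simpa [hA.2] using h i i
  have hi := abs_le.mp (hdiag i)
  have hj := abs_le.mp (hdiag j)
  set w := √(columnGram x i i) * √(columnGram x j j) with hw
  have hw' : w = √(columnGram x i i * columnGram x j j) := by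
    rw [hw, Real.sqrt_mul (by linarith)]
  have hw1 : 1 - d ≤ w := by
    rw [hw']
    apply Real.le_sqrt_of_sq_le
    nlinarith
  have hw2 : w ≤ 1 + d := by
    rw [hw', Real.sqrt_le_left (by linarith)]
    nlinarith
  have hw0 : 0 < w := by linarith
  have hA1 := hA.abs_le_one i j
  rw [geminiA_eq_columnGram hn hf, ← hw, div_sub' hw0.ne', abs_div, abs_of_pos hw0,
    div_le_iff₀ hw0]
  calc |columnGram x i j - w * A i j| = |(columnGram x i j - A i j) + (1 - w) * A i j| := by
        congr 1; ring
    _ ≤ d + d * 1 := by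
        refine (abs_add_le _ _).trans (add_le_add (h i j) ?_)
        rw [abs_mul]
        exact mul_le_mul (abs_le.mpr ⟨by linarith, by linarith⟩) hA1 (abs_nonneg _) hd0
    _ ≤ 4 * d * w := by nlinarith

end Concentration

/-! ### Spectral norm: Schur test, Kronecker products, inverses -/

section SpectralNorm

variable {ι : Type*} [Fintype ι] [DecidableEq ι]

lemma le_dotProduct_mulVec_of_spectrum {A : Matrix ι ι ℝ} (hA : A.IsHermitian) {κ : ℝ}
    (h : ∀ μ ∈ spectrum ℝ A, κ ≤ μ) (x : ι → ℝ) : κ * ∑ i, x i ^ 2 ≤ x ⬝ᵥ A *ᵥ x := by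
  have hsub : (A - algebraMap ℝ (Matrix ι ι ℝ) κ).PosSemidef := by
    rw [posSemidef_iff_isHermitian_and_spectrum_nonneg]
    constructor
    · refine hA.sub ?_
      rw [Algebra.algebraMap_eq_smul_one]
      simp [IsHermitian]
    · rw [← spectrum.sub_singleton_eq]
      rintro _ ⟨μ, hμ, _, rfl, rfl⟩
      simpa using h μ hμ
  have := hsub.dotProduct_mulVec_nonneg x
  rw [Algebra.algebraMap_eq_smul_one, sub_mulVec, smul_mulVec, one_mulVec, dotProduct_sub,
    dotProduct_smul] at this
  simp only [star_trivial, smul_eq_mul, sub_nonneg] at this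
  simpa [dotProduct, sq] using this

lemma sum_sq_mulVec_le (W : Matrix ι ι ℝ) (x : ι → ℝ) :
    ∑ i, (W *ᵥ x) i ^ 2 ≤ specNorm W ^ 2 * ∑ i, x i ^ 2 := by
  have h := (toEuclideanCLM (n := ι) (𝕜 := ℝ) W).le_opNorm (WithLp.toLp 2 x)
  have h2 := pow_le_pow_left₀ (norm_nonneg _) h 2
  rw [mul_pow, EuclideanSpace.real_norm_sq_eq, EuclideanSpace.real_norm_sq_eq] at h2
  exact h2

lemma specNorm_le_of_sum_sq_le {W : Matrix ι ι ℝ} {R : ℝ} (hR : 0 ≤ R)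
    (h : ∀ x : ι → ℝ, ∑ i, (W *ᵥ x) i ^ 2 ≤ R ^ 2 * ∑ i, x i ^ 2) : specNorm W ≤ R := by
  refine ContinuousLinearMap.opNorm_le_bound _ hR fun x => ?_
  refine le_of_sq_le_sq ?_ (by positivity)
  rw [mul_pow, EuclideanSpace.real_norm_sq_eq, EuclideanSpace.real_norm_sq_eq]
  exact h x.ofLp

lemma specNorm_nonneg (W : Matrix ι ι ℝ) : 0 ≤ specNorm W := norm_nonneg _

lemma specNorm_add_le (V W : Matrix ι ι ℝ) : specNorm (V + W) ≤ specNorm V + specNorm W := by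
  unfold specNorm
  rw [map_add]
  exact norm_add_le _ _

lemma specNorm_le_of_isSymm_of_sum_abs_le {E : Matrix ι ι ℝ} (hE : E.IsSymm) {R : ℝ} (hR : 0 ≤ R)
    (h : ∀ j, ∑ i, |E i j| ≤ R) : specNorm E ≤ R := by
  refine specNorm_le_of_sum_sq_le hR fun x => ?_
  have hrow : ∀ i, ∑ j, |E i j| ≤ R := fun i => by
    simpa only [hE.apply] using h i
  calc ∑ i, (E *ᵥ x) i ^ 2 ≤ ∑ i, (∑ j, |E i j|) * ∑ j, |E i j| * x j ^ 2 := by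
        refine Finset.sum_le_sum fun i _ => ?_
        have h1 : |(E *ᵥ x) i| ≤ ∑ j, |E i j| * |x j| := by
          refine (Finset.abs_sum_le_sum_abs _ _).trans_eq ?_
          simp [abs_mul]
        refine (sq_le_sq' (by linarith [(abs_le.mp h1).1]) (abs_le.mp h1).2).trans ?_
        refine Finset.sum_sq_le_sum_mul_sum_of_sq_le_mul _ (fun j _ => abs_nonneg _)
          (fun j _ => by positivity) fun j _ => le_of_eq ?_
        rw [mul_pow, sq_abs (x j)]
        ring
    _ ≤ ∑ i, R * ∑ j, |E i j| * x j ^ 2 := by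
        gcongr with i
        exact hrow i
    _ = R * ∑ j, (∑ i, |E i j|) * x j ^ 2 := by
        rw [← Finset.mul_sum, Finset.sum_comm]
        simp only [Finset.sum_mul]
    _ ≤ R * ∑ j, R * x j ^ 2 := by
        gcongr with j
        exact h j
    _ = R ^ 2 * ∑ i, x i ^ 2 := by rw [← Finset.mul_sum]; ring

/-- V ⊗ W acts by W on the inner index and then by V on the outer one; each step costs its own norm.
-/
lemma specNorm_kronecker_le {κ : Type*} [Fintype κ] [DecidableEq κ] (V : Matrix ι ι ℝ)
    (W : Matrix κ κ ℝ) : specNorm (V ⊗ₖ W) ≤ specNorm V * specNorm W := by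
  refine specNorm_le_of_sum_sq_le (mul_nonneg (specNorm_nonneg _) (specNorm_nonneg _)) fun x => ?_
  set z : ι → κ → ℝ := fun j => W *ᵥ fun l => x (j, l) with hz
  have hmul : ∀ i k, ((V ⊗ₖ W) *ᵥ x) (i, k) = (V *ᵥ fun j => z j k) i := by
    intro i k
    simp only [mulVec, dotProduct, hz, Fintype.sum_prod_type, kroneckerMap_apply, Finset.mul_sum,
      mul_assoc]
  rw [Fintype.sum_prod_type, Fintype.sum_prod_type]
  simp only [hmul]
  rw [Finset.sum_comm]
  calc _ ≤ ∑ k, specNorm V ^ 2 * ∑ j, z j k ^ 2 :=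
        Finset.sum_le_sum fun k _ => sum_sq_mulVec_le V _
    _ = specNorm V ^ 2 * ∑ j, ∑ k, z j k ^ 2 := by rw [← Finset.mul_sum, Finset.sum_comm]
    _ ≤ specNorm V ^ 2 * ∑ j, specNorm W ^ 2 * ∑ l, x (j, l) ^ 2 := by
        gcongr with j
        exact sum_sq_mulVec_le W _
    _ = _ := by rw [← Finset.mul_sum]; ring

lemma specNorm_inv_le {A : Matrix ι ι ℝ} (hA : A.PosDef) {κ : ℝ} (hκ : 0 < κ)
    (h : ∀ μ ∈ spectrum ℝ A, κ ≤ μ) : specNorm A⁻¹ ≤ 1 / κ := by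
  refine specNorm_le_of_sum_sq_le (by positivity) fun x => ?_
  set y := A⁻¹ *ᵥ x with hy
  have hAy : A *ᵥ y = x := by
    rw [hy, mulVec_mulVec, mul_nonsing_inv _ ((isUnit_iff_isUnit_det _).mp hA.isUnit), one_mulVec]
  have h1 := le_dotProduct_mulVec_of_spectrum hA.isHermitian h y
  rw [hAy] at h1
  have h2 : (y ⬝ᵥ x) ^ 2 ≤ (∑ i, y i ^ 2) * ∑ i, x i ^ 2 := Finset.sum_mul_sq_le_sq_mul_sq _ _ _
  have hY : 0 ≤ ∑ i, y i ^ 2 := Finset.sum_nonneg fun i _ => sq_nonneg _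
  have hX : 0 ≤ ∑ i, x i ^ 2 := Finset.sum_nonneg fun i _ => sq_nonneg _
  rcases hY.eq_or_lt with h0 | hpos
  · rw [← h0]; positivity
  · have h3 := (pow_le_pow_left₀ (by positivity) h1 2).trans h2
    rw [mul_pow, sq (∑ i, y i ^ 2), ← mul_assoc, mul_comm _ (∑ i, y i ^ 2)] at h3
    have h4 := le_of_mul_le_mul_left h3 hpos
    rw [div_pow, one_pow, one_div, inv_mul_eq_div, le_div_iff₀ (by positivity)]
    linarith

lemma specNorm_kronecker_sub_le {κ : Type*} [Fintype κ] [DecidableEq κ] (V V' : Matrix ι ι ℝ)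
    (W W' : Matrix κ κ ℝ) :
    specNorm (V ⊗ₖ W - V' ⊗ₖ W') ≤
      specNorm (V - V') * (specNorm W' + specNorm (W - W')) +
        specNorm V' * specNorm (W - W') := by
  have heq : V ⊗ₖ W - V' ⊗ₖ W' = (V - V') ⊗ₖ W + V' ⊗ₖ (W - W') := by
    ext ⟨i, k⟩ ⟨j, l⟩
    simp only [Matrix.sub_apply, Matrix.add_apply, kroneckerMap_apply]
    ring
  have hW : specNorm W ≤ specNorm W' + specNorm (W - W') := by
    simpa using specNorm_add_le W' (W - W')
  rw [heq]
  refine (specNorm_add_le _ _).trans (add_le_add ((specNorm_kronecker_le _ _).trans ?_)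
    (specNorm_kronecker_le _ _))
  exact mul_le_mul_of_nonneg_left hW (specNorm_nonneg _)

end SpectralNorm

/-! ### The SCIO objective: expansion, existence of minimizers, optimality -/

section ScioLoss

variable {ι : Type*} [Fintype ι]

lemma dotProduct_mulVec_comm_of_isSymm {S : Matrix ι ι ℝ} (hS : S.IsSymm) (x y : ι → ℝ) :
    x ⬝ᵥ S *ᵥ y = y ⬝ᵥ S *ᵥ x := by
  rw [dotProduct_mulVec, ← mulVec_transpose, hS.eq, dotProduct_comm]

lemma scioLoss_sub_scioLoss [DecidableEq ι] {S : Matrix ι ι ℝ} (hS : S.IsSymm) (lam : ℝ) (i : ι)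
    (b w : ι → ℝ) :
    scioLoss S lam i b - scioLoss S lam i w = 1 / 2 * ((b - w) ⬝ᵥ S *ᵥ (b - w)) +
      (b - w) ⬝ᵥ (S *ᵥ w - Pi.single i 1) + lam * (∑ j, |b j| - ∑ j, |w j|) := by
  have h := dotProduct_mulVec_comm_of_isSymm hS b w
  simp only [scioLoss, mulVec_sub, dotProduct_sub, sub_dotProduct, dotProduct_single_one, h, Pi.sub_apply]
  ring

lemma abs_dotProduct_le_of_abs_le (x y : ι → ℝ) {c : ℝ} (h : ∀ i, |y i| ≤ c) :
    |x ⬝ᵥ y| ≤ c * ∑ i, |x i| := by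
  rw [Finset.mul_sum]
  refine (Finset.abs_sum_le_sum_abs _ _).trans (Finset.sum_le_sum fun i _ => ?_)
  rw [abs_mul, mul_comm]
  exact mul_le_mul_of_nonneg_right (h i) (abs_nonneg _)

/-- A minimizer of the objective exists as soon as some vector is strictly feasible. -/
lemma exists_forall_scioLoss_le [DecidableEq ι] {S : Matrix ι ι ℝ} (hS : S.IsSymm)
    (hpsd : ∀ x, 0 ≤ x ⬝ᵥ S *ᵥ x) {lam c : ℝ} (hc : c < lam) (i : ι) {w : ι → ℝ}
    (hw : ∀ k, |(S *ᵥ w - Pi.single i 1 : ι → ℝ) k| ≤ c) :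
    ∃ b, ∀ b', scioLoss S lam i b ≤ scioLoss S lam i b' := by
  have hcont : Continuous (scioLoss S lam i) := by
    unfold scioLoss dotProduct mulVec dotProduct
    fun_prop
  refine hcont.exists_forall_le ?_
  -- Coercivity: the linear term loses at most c per unit of ℓ₁ norm while the penalty gains `lam`.
  have hbound : ∀ b : ι → ℝ, (lam - c) * ‖b‖ + (scioLoss S lam i w - (lam + c) * ∑ j, |w j|) ≤
      scioLoss S lam i b := by
    intro b
    have h1 := scioLoss_sub_scioLoss hS lam i b w
    have h2 := (abs_le.mp (abs_dotProduct_le_of_abs_le (b - w) _ hw)).1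
    have hc0 : 0 ≤ c := (abs_nonneg _).trans (hw i)
    have h3 : ∑ j, |(b - w) j| ≤ ∑ j, |b j| + ∑ j, |w j| := by
      rw [← Finset.sum_add_distrib]
      exact Finset.sum_le_sum fun j _ => abs_sub _ _
    have h4 : ‖b‖ ≤ ∑ j, |b j| := by
      refine (pi_norm_le_iff_of_nonneg (Finset.sum_nonneg fun _ _ => abs_nonneg _)).mpr fun j => ?_
      exact Finset.single_le_sum (f := fun j => |b j|) (fun _ _ => abs_nonneg _)
        (Finset.mem_univ j)
    have h5 := mul_le_mul_of_nonneg_left h3 hc0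
    have h6 := mul_le_mul_of_nonneg_left h4 (sub_pos.mpr hc).le
    linarith [hpsd (b - w)]
  refine tendsto_atTop_mono hbound (tendsto_atTop_add_const_right _ _ ?_)
  exact tendsto_norm_cocompact_atTop.const_mul_atTop (sub_pos.mpr hc)

lemma abs_le_of_forall_mul_add_sq {g d c : ℝ}
    (h : ∀ t : ℝ, 0 ≤ t * g + t ^ 2 * d + c * |t|) : |g| ≤ c := by
  have key : ∀ s : ℝ, |s| = 1 → s * g ≤ c := by
    intro s hs
    refine le_of_forall_pos_le_add fun ε hε => ?_
    set t := ε / (1 + |d|) with ht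
    have ht0 : 0 < t := by positivity
    have h1 := h (-(t * s))
    rw [abs_neg, abs_mul, hs, mul_one, abs_of_pos ht0, neg_sq, mul_pow, ← sq_abs s, hs] at h1
    have h2 : t * d ≤ ε := by
      have : t * (1 + |d|) = ε := by rw [ht]; field_simp
      nlinarith [le_abs_self d]
    have h3 : 0 ≤ t * (-(s * g) + t * d + c) := by nlinarith
    have := nonneg_of_mul_nonneg_right h3 ht0
    linarith
  rw [abs_le]
  constructor
  · linarith [key (-1) (by simp)]
  · linarith [key 1 (by simp)]

/-- First-order optimality condition. -/
lemma abs_mulVec_sub_single_le_of_forall_scioLoss_le [DecidableEq ι] {S : Matrix ι ι ℝ}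
    (hS : S.IsSymm) {lam : ℝ} (hlam : 0 ≤ lam) {i : ι} {b : ι → ℝ}
    (hb : ∀ b', scioLoss S lam i b ≤ scioLoss S lam i b') (k : ι) :
    |(S *ᵥ b - Pi.single i 1 : ι → ℝ) k| ≤ lam := by
  refine abs_le_of_forall_mul_add_sq (d := 1 / 2 * S k k) fun t => ?_
  have h1 := scioLoss_sub_scioLoss hS lam i (b + Pi.single k t) b
  have h2 := hb (b + Pi.single k t)
  have h3 : ∑ j, |(b + Pi.single k t : ι → ℝ) j| ≤ ∑ j, |b j| + |t| := by
    calc _ ≤ ∑ j, (|b j| + |(Pi.single k t : ι → ℝ) j|) :=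
          Finset.sum_le_sum fun j _ => abs_add_le _ _
      _ = _ := by
          rw [Finset.sum_add_distrib]
          congr 1
          simp [Pi.single_apply, apply_ite abs]
  have h4 : lam * (∑ j, |(b + Pi.single k t : ι → ℝ) j| - ∑ j, |b j|) ≤ lam * |t| :=
    mul_le_mul_of_nonneg_left (by linarith) hlam
  rw [add_sub_cancel_left] at h1
  have h5 : (Pi.single k t : ι → ℝ) ⬝ᵥ S *ᵥ Pi.single k t = t ^ 2 * S k k := by
    rw [single_dotProduct, mulVec_single]
    simp
    ring
  rw [h5, single_dotProduct] at h1
  linarith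

end ScioLoss

/-! ### Counting large entries and summing small ones under ℓ_q sparsity -/

section Thresholding

variable {ι : Type*} [Fintype ι]

lemma absPow_nonneg (q x : ℝ) : 0 ≤ absPow q x := by
  unfold absPow
  split_ifs <;> positivity

lemma rpow_le_absPow {q x τ : ℝ} (hq : 0 ≤ q) (hτ : 0 < τ) (h : τ ≤ |x|) :
    τ ^ q ≤ absPow q x := by
  have hx : x ≠ 0 := abs_pos.mp (hτ.trans_le h)
  rw [absPow, if_neg hx]
  exact Real.rpow_le_rpow hτ.le h hq

lemma abs_le_absPow_mul {q x τ : ℝ} (hq : q ≤ 1) (hτ : 0 < τ) (h : |x| ≤ τ) :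
    |x| ≤ absPow q x * (τ ^ (-q) * τ) := by
  rcases eq_or_ne x 0 with rfl | hx
  · simp [absPow]
  have hx0 : 0 < |x| := abs_pos.mpr hx
  rw [absPow, if_neg hx]
  calc |x| = |x| ^ q * |x| ^ (1 - q) := by rw [← Real.rpow_add hx0]; simp
    _ ≤ |x| ^ q * τ ^ (1 - q) := by
        gcongr
    _ = _ := by
        rw [show (1 - q) = -q + 1 by ring, Real.rpow_add hτ, Real.rpow_one]

variable {q s τ : ℝ} {w : ι → ℝ}

lemma card_filter_lt_abs_le (hq : 0 ≤ q) (hτ : 0 < τ) (hw : ∑ j, absPow q (w j) ≤ s) :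
    ((Finset.univ.filter fun j => τ < |w j|).card : ℝ) ≤ s * τ ^ (-q) := by
  rw [Real.rpow_neg hτ.le, ← div_eq_mul_inv, le_div_iff₀ (by positivity), ← nsmul_eq_mul]
  refine (Finset.card_nsmul_le_sum _ (fun j => absPow q (w j)) _ fun j hj => ?_).trans
    ((Finset.sum_le_univ_sum_of_nonneg fun j => absPow_nonneg _ _).trans hw)
  exact rpow_le_absPow hq hτ (Finset.mem_filter.mp hj).2.le

lemma sum_filter_not_lt_abs_le (hq : q ≤ 1) (hτ : 0 < τ) (hw : ∑ j, absPow q (w j) ≤ s) :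
    ∑ j with ¬ τ < |w j|, |w j| ≤ s * τ ^ (-q) * τ := by
  calc _ ≤ ∑ j with ¬ τ < |w j|, absPow q (w j) * (τ ^ (-q) * τ) :=
        Finset.sum_le_sum fun j hj =>
          abs_le_absPow_mul hq hτ (not_lt.mp (Finset.mem_filter.mp hj).2)
    _ ≤ ∑ j, absPow q (w j) * (τ ^ (-q) * τ) :=
        Finset.sum_le_univ_sum_of_nonneg fun j => mul_nonneg (absPow_nonneg _ _) (by positivity)
    _ ≤ s * (τ ^ (-q) * τ) := by
        rw [← Finset.sum_mul]
        gcongr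
    _ = _ := by ring

end Thresholding

/-! ### Deterministic error bounds for SCIO -/

section ScioError

variable {ι : Type*} [Fintype ι] [DecidableEq ι]

lemma dotProduct_mulVec_sub_le {ι : Type*} [Fintype ι] {S A : Matrix ι ι ℝ} {ρ : ℝ} (h : ∀ i j, |S i j - A i j| ≤ ρ)
    (x : ι → ℝ) : x ⬝ᵥ A *ᵥ x - ρ * (∑ j, |x j|) ^ 2 ≤ x ⬝ᵥ S *ᵥ x := by
  have h1 : ∀ i, |((S - A) *ᵥ x) i| ≤ ρ * ∑ j, |x j| := fun i => by
    rw [mulVec, dotProduct_comm]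
    exact abs_dotProduct_le_of_abs_le _ _ fun j => h i j
  have h2 := (abs_le.mp (abs_dotProduct_le_of_abs_le x _ h1)).1
  rw [sub_mulVec, dotProduct_sub] at h2
  linarith

/-- Here σ = sλ^(-q) is the effective sparsity, G the empirical quadratic form of the error, T and E
its ℓ₁ and squared ℓ₂ norms, and D its ℓ₁ norm on large coordinates. Dropping G gives the cone bound
T ≤ 4D + 4σλ; hence ρT² is absorbed by half of κE, and AM-GM absorbs 4λD into the other half. -/
lemma le_of_scio_basic_inequality {κ ρ σ lam G T D E : ℝ} (hκ : 0 < κ) (hlam : 0 < lam)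
    (hρ0 : 0 ≤ ρ) (hσ : 0 ≤ σ) (hρ : ρ * σ ≤ κ / 64) (hG0 : 0 ≤ G) (hT : 0 ≤ T) (hE : 0 ≤ E)
    (hG : κ * E - ρ * T ^ 2 ≤ G) (hD : D ^ 2 ≤ σ * E)
    (h : G + lam * T ≤ 4 * lam * D + 4 * σ * lam ^ 2) :
    T ≤ (4 + κ / 2 + 8 / κ) * (σ * lam) := by
  have hT1 : T ≤ 4 * D + 4 * σ * lam := by
    refine le_of_mul_le_mul_left ?_ hlam
    nlinarith
  have hT2 : T ^ 2 ≤ 32 * (σ * E) + 32 * (σ * lam) ^ 2 := by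
    have := pow_le_pow_left₀ hT hT1 2
    nlinarith [sq_nonneg (D - σ * lam)]
  have hT3 : ρ * T ^ 2 ≤ κ / 2 * E + κ / 2 * (σ * lam ^ 2) := by
    calc ρ * T ^ 2 ≤ ρ * (32 * (σ * E) + 32 * (σ * lam) ^ 2) := by gcongr
      _ = 32 * (ρ * σ) * (E + σ * lam ^ 2) := by ring
      _ ≤ 32 * (κ / 64) * (E + σ * lam ^ 2) := by gcongr
      _ = _ := by ring
  have hamgm : 4 * lam * D ≤ κ / 2 * E + 8 / κ * (σ * lam ^ 2) := by
    refine le_of_sq_le_sq ?_ (by positivity)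
    have h1 : (κ / 2 * E + 8 / κ * (σ * lam ^ 2)) ^ 2 =
        (κ / 2 * E - 8 / κ * (σ * lam ^ 2)) ^ 2 + 16 * lam ^ 2 * (σ * E) := by
      field_simp
      ring
    rw [h1]
    have h2 := mul_le_mul_of_nonneg_left hD (by positivity : 0 ≤ 16 * lam ^ 2)
    nlinarith [sq_nonneg (κ / 2 * E - 8 / κ * (σ * lam ^ 2))]
  refine le_of_mul_le_mul_left ?_ hlam
  have h5 : lam * ((4 + κ / 2 + 8 / κ) * (σ * lam)) =
      4 * σ * lam ^ 2 + κ / 2 * (σ * lam ^ 2) + 8 / κ * (σ * lam ^ 2) := by ring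
  rw [h5]
  linarith

/-- `ℓ₁` error of a SCIO column. -/
lemma sum_abs_sub_le_of_forall_scioLoss_le {S A : Matrix ι ι ℝ} (hS : S.IsSymm)
    (hpsd : ∀ x, 0 ≤ x ⬝ᵥ S *ᵥ x) {κ ρ lam q s : ℝ} (hκ : 0 < κ)
    (hA : ∀ x : ι → ℝ, κ * ∑ i, x i ^ 2 ≤ x ⬝ᵥ A *ᵥ x) (hSA : ∀ i j, |S i j - A i j| ≤ ρ)
    (hlam : 0 < lam) (hq0 : 0 ≤ q) (hq1 : q ≤ 1) {i : ι} {b w : ι → ℝ}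
    (hw : ∑ j, absPow q (w j) ≤ s)
    (hfeas : ∀ k, |(S *ᵥ w - Pi.single i 1 : ι → ℝ) k| ≤ lam / 2)
    (hρ : ρ * (s * lam ^ (-q)) ≤ κ / 64)
    (hb : ∀ b', scioLoss S lam i b ≤ scioLoss S lam i b') :
    ∑ j, |b j - w j| ≤ (4 + κ / 2 + 8 / κ) * (s * lam ^ (-q) * lam) := by
  have hρ0 : 0 ≤ ρ := (abs_nonneg _).trans (hSA i i)
  have hs0 : 0 ≤ s := (Finset.sum_nonneg fun j _ => absPow_nonneg q (w j)).trans hw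
  set σ := s * lam ^ (-q) with hσ
  have hσ0 : 0 ≤ σ := by positivity
  set D := ∑ j with lam < |w j|, |b j - w j| with hDdef
  have hD : D ^ 2 ≤ σ * ∑ j, (b j - w j) ^ 2 := by
    refine (sq_sum_le_card_mul_sum_sq).trans ?_
    refine mul_le_mul (card_filter_lt_abs_le hq0 hlam hw) ?_
      (Finset.sum_nonneg fun _ _ => sq_nonneg _) hσ0
    simp only [sq_abs]
    exact Finset.sum_le_univ_sum_of_nonneg fun j => sq_nonneg _
  have hsmall := sum_filter_not_lt_abs_le hq1 hlam hw
  -- On large coordinates |b| - |w| ≥ -|b - w|; on the others |b| - |w| ≥ |b - w| - 2|w|, where |w|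
  -- sums to at most σλ.
  have hcone : ∑ j, |b j - w j| - 2 * D - 2 * (σ * lam) ≤ ∑ j, |b j| - ∑ j, |w j| := by
    have hsplit : ∀ g : ι → ℝ, ∑ j, g j = ∑ j with lam < |w j|, g j +
        ∑ j with ¬ lam < |w j|, g j := fun g =>
      (Finset.sum_filter_add_sum_filter_not _ _ _).symm
    have hJ : -D ≤ ∑ j with lam < |w j|, (|b j| - |w j|) := by
      rw [hDdef, ← Finset.sum_neg_distrib]
      refine Finset.sum_le_sum fun j _ => ?_
      have := abs_sub_abs_le_abs_sub (w j) (b j)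
      rw [abs_sub_comm] at this
      linarith
    have hJc : ∑ j with ¬ lam < |w j|, |b j - w j| - 2 * ∑ j with ¬ lam < |w j|, |w j| ≤
        ∑ j with ¬ lam < |w j|, (|b j| - |w j|) := by
      rw [Finset.mul_sum, ← Finset.sum_sub_distrib]
      refine Finset.sum_le_sum fun j _ => ?_
      linarith [abs_sub (b j) (w j)]
    rw [← Finset.sum_sub_distrib, hsplit fun j => |b j - w j|, hsplit fun j => |b j| - |w j|]
    linarith
  have hbasic := scioLoss_sub_scioLoss hS lam i b w
  have hlin := (abs_le.mp (abs_dotProduct_le_of_abs_le (b - w) _ hfeas)).1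
  have hmul := mul_le_mul_of_nonneg_left hcone hlam.le
  have hquad := (sub_le_sub_right (hA (b - w)) _).trans (dotProduct_mulVec_sub_le hSA (b - w))
  simp only [Pi.sub_apply] at hlin hquad
  refine le_of_scio_basic_inequality hκ hlam hρ0 hσ0 hρ (hpsd (b - w))
    (Finset.sum_nonneg fun _ _ => abs_nonneg _) (Finset.sum_nonneg fun _ _ => sq_nonneg _)
    hquad hD ?_
  linarith [hb w]

/-- Entrywise error of a SCIO column. -/
lemma abs_sub_le_of_forall_scioLoss_le {S A Θ : Matrix ι ι ℝ} (hS : S.IsSymm)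
    {ρ lam M T : ℝ} (hSA : ∀ i j, |S i j - A i j| ≤ ρ) (hlam : 0 ≤ lam)
    (hΘA : Θ * A = 1) (hΘ : ∀ k, ∑ j, |Θ k j| ≤ M) {i : ι} {b w : ι → ℝ}
    (hfeas : ∀ k, |(S *ᵥ w - Pi.single i 1 : ι → ℝ) k| ≤ lam / 2)
    (hb : ∀ b', scioLoss S lam i b ≤ scioLoss S lam i b')
    (hT : ∑ j, |b j - w j| ≤ T) (k : ι) :
    |b k - w k| ≤ M * (3 / 2 * lam + ρ * T) := by
  have hρ0 : 0 ≤ ρ := (abs_nonneg _).trans (hSA i i)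
  have hT0 : 0 ≤ T := (Finset.sum_nonneg fun _ _ => abs_nonneg _).trans hT
  -- The optimality residual of b costs λ, the feasibility residual of w costs λ/2, and replacing S
  -- by A costs ρT.
  have hAd : ∀ l, |(A *ᵥ (b - w)) l| ≤ 3 / 2 * lam + ρ * T := by
    intro l
    have h1 := abs_mulVec_sub_single_le_of_forall_scioLoss_le hS hlam hb l
    have h2 := hfeas l
    have h3 : |((S - A) *ᵥ (b - w)) l| ≤ ρ * ∑ j, |(b - w) j| := by
      rw [mulVec, dotProduct_comm]
      exact abs_dotProduct_le_of_abs_le _ _ fun j => hSA l j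
    have h4 : ρ * ∑ j, |(b - w) j| ≤ ρ * T := mul_le_mul_of_nonneg_left hT hρ0
    have h5 : (A *ᵥ (b - w)) l = (S *ᵥ b - Pi.single i 1 : ι → ℝ) l -
        (S *ᵥ w - Pi.single i 1 : ι → ℝ) l - ((S - A) *ᵥ (b - w)) l := by
      simp only [sub_mulVec, mulVec_sub, Pi.sub_apply]
      ring
    rw [h5]
    refine (abs_sub _ _).trans ?_
    linarith [abs_sub ((S *ᵥ b - Pi.single i 1 : ι → ℝ) l) ((S *ᵥ w - Pi.single i 1 : ι → ℝ) l)]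
  have hk : b k - w k = Θ k ⬝ᵥ A *ᵥ (b - w) := by
    have : Θ *ᵥ A *ᵥ (b - w) = b - w := by rw [mulVec_mulVec, hΘA, one_mulVec]
    exact (congrFun this k).symm
  rw [hk, mul_comm M]
  refine (abs_dotProduct_le_of_abs_le _ _ hAd).trans ?_
  exact mul_le_mul_of_nonneg_left (hΘ k) (by positivity)

lemma exists_isMinSymmetrization {ι : Type*} (W : Matrix ι ι ℝ) :
    ∃ V, IsMinSymmetrization W V := by
  -- In a tie the two entries may have opposite signs; `max` is a choice invariant under swapping
  -- the indices, as symmetry requires.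
  refine ⟨of fun i j => if |W i j| < |W j i| then W i j else if |W j i| < |W i j| then W j i
    else max (W i j) (W j i), ?_, fun i j => ?_⟩
  · ext i j
    simp only [transpose_apply, of_apply]
    split_ifs with h1 h2 h3
    · exact absurd h1 h2.not_gt
    all_goals first | rfl | exact max_comm _ _
  · simp only [of_apply]
    split_ifs with h1 h2
    · exact Or.inl ⟨rfl, h1.le⟩
    · exact Or.inr ⟨rfl, h2.le⟩
    · rcases max_choice (W i j) (W j i) with h | h
      · exact Or.inl ⟨h, not_lt.mp h2⟩
      · exact Or.inr ⟨h, not_lt.mp h1⟩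

lemma IsMinSymmetrization.abs_le {ι : Type*} {W V : Matrix ι ι ℝ} (h : IsMinSymmetrization W V)
    (i j : ι) : |V i j| ≤ |W i j| := by
  rcases h.2 i j with ⟨h1, -⟩ | ⟨h1, h2⟩ <;> rw [h1]
  exact h2

lemma IsMinSymmetrization.abs_sub_le {ι : Type*} {W V Θ : Matrix ι ι ℝ}
    (h : IsMinSymmetrization W V) (hΘ : Θ.IsSymm) {ε : ℝ} (hε : ∀ i j, |W i j - Θ i j| ≤ ε)
    (i j : ι) : |V i j - Θ i j| ≤ ε := by
  rcases h.2 i j with ⟨h1, -⟩ | ⟨h1, -⟩ <;> rw [h1]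
  · exact hε i j
  · rw [← hΘ.apply i j]
    exact hε j i

/-- Where Θ is large, count entries and use the entrywise error. Where it is small, |V - Θ| ≤ |W| +
|Θ| ≤ |W - Θ| + 2|Θ| stays within the same column. -/
lemma IsMinSymmetrization.sum_abs_sub_le {ι : Type*} [Fintype ι] {W V Θ : Matrix ι ι ℝ} (h : IsMinSymmetrization W V)
    (hΘ : Θ.IsSymm) {ε q s τ T : ℝ} (hε : ∀ i j, |W i j - Θ i j| ≤ ε) (hq0 : 0 ≤ q) (hq1 : q ≤ 1)
    (hτ : 0 < τ) (hs : ∀ j, ∑ i, absPow q (Θ i j) ≤ s) (hT : ∀ j, ∑ i, |W i j - Θ i j| ≤ T)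
    (j : ι) : ∑ i, |V i j - Θ i j| ≤ s * τ ^ (-q) * ε + 2 * (s * τ ^ (-q) * τ) + T := by
  have hε0 : 0 ≤ ε := (abs_nonneg _).trans (hε j j)
  rw [← Finset.sum_filter_add_sum_filter_not Finset.univ fun i => τ < |Θ i j|, add_assoc]
  refine add_le_add ?_ ?_
  · refine (Finset.sum_le_card_nsmul _ _ ε fun i _ => h.abs_sub_le hΘ hε i j).trans ?_
    rw [nsmul_eq_mul]
    exact mul_le_mul_of_nonneg_right (card_filter_lt_abs_le hq0 hτ (hs j)) hε0
  · calc ∑ i with ¬ τ < |Θ i j|, |V i j - Θ i j|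
        ≤ ∑ i with ¬ τ < |Θ i j|, (2 * |Θ i j| + |W i j - Θ i j|) := by
          refine Finset.sum_le_sum fun i _ => ?_
          have h1 := abs_sub (V i j) (Θ i j)
          have h2 := h.abs_le i j
          have h3 := abs_sub_abs_le_abs_sub (W i j) (Θ i j)
          linarith
      _ = 2 * ∑ i with ¬ τ < |Θ i j|, |Θ i j| + ∑ i with ¬ τ < |Θ i j|, |W i j - Θ i j| := by
          rw [Finset.sum_add_distrib, Finset.mul_sum]
      _ ≤ _ := by
          refine add_le_add ?_ ((Finset.sum_le_univ_sum_of_nonneg fun i => abs_nonneg _).trans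
            (hT j))
          exact mul_le_mul_of_nonneg_left (sum_filter_not_lt_abs_le hq1 hτ (hs j)) zero_le_two

/-- Existence of SCIO estimates and their error in spectral norm. -/
theorem exists_isScio_and_specNorm_sub_inv_le [Nonempty ι] {S A : Matrix ι ι ℝ} (hS : S.IsSymm)
    (hpsd : ∀ x, 0 ≤ x ⬝ᵥ S *ᵥ x) (hA : A.PosDef) {κ ρ lam q s M : ℝ} (hκ : 0 < κ)
    (hspec : ∀ μ ∈ spectrum ℝ A, κ ≤ μ) (hSA : ∀ i j, |S i j - A i j| ≤ ρ)
    (hlam : 0 < lam) (hq0 : 0 ≤ q) (hq1 : q < 1) (hsparse : SparseClass q s M A⁻¹) (hM : 1 ≤ M)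
    (hρM : ρ * M ≤ lam / 2) (hρ : ρ * (s * lam ^ (-q)) ≤ κ / 64) :
    (∃ V, IsScio S lam V) ∧ ∀ V, IsScio S lam V → specNorm (V - A⁻¹) ≤
      (7 / 2 + (4 + κ / 2 + 8 / κ) * (1 + κ / 64)) * (s * (M * lam) ^ (1 - q)) := by
  obtain ⟨hPD, hs, hMs⟩ := hsparse
  obtain ⟨i₀⟩ := ‹Nonempty ι›
  have hdet : IsUnit A.det := (isUnit_iff_isUnit_det _).mp hA.isUnit
  have hsymm : (A⁻¹).IsSymm := by
    have := hPD.isHermitian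
    rwa [IsHermitian, conjTranspose_eq_transpose_of_trivial] at this
  have hρ0 : 0 ≤ ρ := (abs_nonneg _).trans (hSA i₀ i₀)
  have hs0 : 0 ≤ s := (Finset.sum_nonneg fun i _ => absPow_nonneg q _).trans (hs i₀)
  have hfeas : ∀ i k, |(S *ᵥ (fun j => A⁻¹ j i) - Pi.single i 1 : ι → ℝ) k| ≤ lam / 2 := by
    intro i k
    have h1 : A *ᵥ (fun j => A⁻¹ j i) = Pi.single i 1 := by
      ext k
      have : (A * A⁻¹) k i = (1 : Matrix ι ι ℝ) k i := by rw [mul_nonsing_inv _ hdet]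
      rw [one_apply] at this
      rw [Pi.single_apply]
      exact this
    rw [← h1, ← sub_mulVec, mulVec, dotProduct_comm]
    refine (abs_dotProduct_le_of_abs_le _ _ fun j => hSA k j).trans ?_
    exact (mul_le_mul_of_nonneg_left (hMs i) hρ0).trans hρM
  refine ⟨?_, ?_⟩
  · have := fun i => exists_forall_scioLoss_le hS hpsd (half_lt_self hlam) i (hfeas i)
    choose b hb using this
    obtain ⟨V, hV⟩ := exists_isMinSymmetrization (of fun j i => b i j)
    exact ⟨V, _, hb, hV⟩
  · rintro V ⟨W, hW, hV⟩
    set c₁ := 4 + κ / 2 + 8 / κ with hc₁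
    have hc₁0 : 0 < c₁ := by positivity
    have hT : ∀ i, ∑ j, |W j i - A⁻¹ j i| ≤ c₁ * (s * lam ^ (-q) * lam) := fun i =>
      sum_abs_sub_le_of_forall_scioLoss_le hS hpsd hκ
        (le_dotProduct_mulVec_of_spectrum hA.isHermitian hspec) hSA hlam hq0 hq1.le (hs i)
        (hfeas i) hρ (hW i)
    have hρT : ρ * (c₁ * (s * lam ^ (-q) * lam)) ≤ c₁ * (κ / 64) * lam := by
      calc _ = c₁ * (ρ * (s * lam ^ (-q))) * lam := by ring
        _ ≤ _ := by gcongr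
    have hε : ∀ j i, |W j i - A⁻¹ j i| ≤ (3 / 2 + c₁ * (κ / 64)) * (M * lam) := by
      intro j i
      refine (abs_sub_le_of_forall_scioLoss_le (M := M) hS hSA hlam.le (nonsing_inv_mul _ hdet)
        (fun k => ?_) (hfeas i) (hW i) (hT i) j).trans ?_
      · simpa only [hsymm.apply] using hMs k
      · calc _ ≤ M * (3 / 2 * lam + c₁ * (κ / 64) * lam) := by gcongr
          _ = _ := by ring
    have hM0 : 0 < M := by linarith
    have hpow : ∀ τ : ℝ, 0 < τ → s * τ ^ (-q) * τ = s * τ ^ (1 - q) := fun τ hτ => by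
      rw [show (1 - q) = -q + 1 by ring, Real.rpow_add hτ, Real.rpow_one, mul_assoc]
    have hmono : s * lam ^ (1 - q) ≤ s * (M * lam) ^ (1 - q) := by
      gcongr
      nlinarith
    have hVsymm : (V - A⁻¹).IsSymm := hV.1.sub hsymm
    refine specNorm_le_of_isSymm_of_sum_abs_le hVsymm (by positivity) fun j => ?_
    -- The threshold Mλ matches the entrywise error, so large and small entries both contribute
    -- order s(Mλ)^(1-q).
    refine (hV.sum_abs_sub_le hsymm hε hq0 hq1.le (mul_pos hM0 hlam) hs hT j).trans ?_
    rw [hpow lam hlam, hpow _ (mul_pos hM0 hlam)]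
    calc _ = (3 / 2 + c₁ * (κ / 64)) * (s * (M * lam) ^ (-q) * (M * lam)) +
          2 * (s * (M * lam) ^ (1 - q)) + c₁ * (s * lam ^ (1 - q)) := by ring
      _ ≤ (3 / 2 + c₁ * (κ / 64)) * (s * (M * lam) ^ (1 - q)) +
          2 * (s * (M * lam) ^ (1 - q)) + c₁ * (s * (M * lam) ^ (1 - q)) := by
        rw [hpow _ (mul_pos hM0 hlam)]
        gcongr
      _ = _ := by ring

end ScioError

/-! ### One Kronecker factor: from the Gram event to the rate -/

section Factor

variable {n f m : ℕ}

lemma geminiA_isSymm (x : Fin n → Matrix (Fin f) (Fin m) ℝ) : (geminiA x).IsSymm := by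
  ext i j
  simp only [transpose_apply, geminiA, of_apply, mul_comm]

/-- The estimator is the Gram matrix of the normalised columns; a zero column causes no harm, since
division by 0 gives 0 on both sides. -/
lemma geminiA_dotProduct_mulVec_nonneg (x : Fin n → Matrix (Fin f) (Fin m) ℝ) (v : Fin m → ℝ) :
    0 ≤ v ⬝ᵥ geminiA x *ᵥ v := by
  set d : Fin m → ℝ := fun i => √(∑ t, ∑ l, x t l i * x t l i) with hd
  have : v ⬝ᵥ geminiA x *ᵥ v = ∑ t, ∑ l, (∑ i, v i * x t l i / d i) ^ 2 := by
    have h : ∀ t l, (∑ i, v i * x t l i / d i) ^ 2 =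
        ∑ i, ∑ j, v i * (x t l i * x t l j / (d i * d j) * v j) := by
      intro t l
      rw [sq, Finset.sum_mul_sum]
      refine Finset.sum_congr rfl fun i _ => Finset.sum_congr rfl fun j _ => ?_
      ring
    simp only [h]
    have h2 : ∀ t, ∑ l, ∑ i, ∑ j, v i * (x t l i * x t l j / (d i * d j) * v j) =
        ∑ i, ∑ j, ∑ l, v i * (x t l i * x t l j / (d i * d j) * v j) := by
      intro t
      rw [Finset.sum_comm]
      exact Finset.sum_congr rfl fun i _ => Finset.sum_comm
    simp only [h2]
    rw [Finset.sum_comm]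
    simp only [dotProduct, mulVec, Finset.mul_sum]
    refine Finset.sum_congr rfl fun i _ => ?_
    rw [Finset.sum_comm]
    refine Finset.sum_congr rfl fun j _ => ?_
    simp only [geminiA, of_apply, Finset.sum_div, Finset.sum_mul, Finset.mul_sum, hd]
  rw [this]
  positivity

variable {A : Matrix (Fin m) (Fin m) ℝ} {q s M : ℝ}

lemma one_le_sum_abs_inv (hA : IsCorrelation A) (j : Fin m) : 1 ≤ ∑ i, |A⁻¹ i j| := by
  have h1 : (A * A⁻¹) j j = 1 := by
    rw [mul_nonsing_inv _ ((isUnit_iff_isUnit_det _).mp hA.1.isUnit), one_apply_eq]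
  have h2 := abs_dotProduct_le_of_abs_le (fun i => A⁻¹ i j) (A j) fun i => hA.abs_le_one j i
  rw [dotProduct_comm, show A j ⬝ᵥ (fun i => A⁻¹ i j) = 1 from h1] at h2
  simpa using h2

lemma SparseClass.one_le_right (h : SparseClass q s M A⁻¹) (hA : IsCorrelation A) (hm : 0 < m) :
    1 ≤ M :=
  (one_le_sum_abs_inv hA ⟨0, hm⟩).trans (h.2.2 _)

/-- Either some entry of the column exceeds 1 and contributes at least 1 alone, or |x| ≤ |x|^q
throughout and the ℓ₁ norm, which is at least 1, is a lower bound. -/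
lemma SparseClass.one_le_left (h : SparseClass q s M A⁻¹) (hA : IsCorrelation A) (hm : 0 < m)
    (hq0 : 0 ≤ q) (hq1 : q ≤ 1) : 1 ≤ s := by
  refine le_trans ?_ (h.2.1 ⟨0, hm⟩)
  by_cases hbig : ∃ i, 1 < |A⁻¹ i ⟨0, hm⟩|
  · obtain ⟨i, hi⟩ := hbig
    have h1 := rpow_le_absPow hq0 one_pos hi.le
    rw [Real.one_rpow] at h1
    exact h1.trans (Finset.single_le_sum (f := fun i => absPow q (A⁻¹ i ⟨0, hm⟩))
      (fun _ _ => absPow_nonneg _ _) (Finset.mem_univ i))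
  · push Not at hbig
    refine (one_le_sum_abs_inv hA ⟨0, hm⟩).trans (Finset.sum_le_sum fun i _ => ?_)
    simpa using abs_le_absPow_mul hq1 one_pos (hbig i)

/-- Deterministic bound for one Kronecker factor, on the event that the Gram matrix of the columns
is close to `A`. -/
lemma exists_isScio_geminiA_and_specNorm_sub_inv_le (hn : 0 < n) (hf : 0 < f) (hm : 0 < m)
    (hA : IsCorrelation A) {κ₁ κ₂ C r : ℝ} (hκ₁ : 0 < κ₁) (hκ₂ : 0 < κ₂)
    (hspec : ∀ μ ∈ spectrum ℝ A, κ₁ ≤ μ) (hq0 : 0 ≤ q) (hq1 : q < 1)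
    (hsparse : SparseClass q s M A⁻¹) (hC : 128 * κ₂ ≤ C) (hr0 : 0 < r)
    (hr : r ≤ 1 / (32 * κ₂))
    (hδ : s * M ^ (2 - 2 * q) * r ^ (1 - q) ≤ C ^ q * κ₁ / (64 * (64 * κ₂)))
    {x : Fin n → Matrix (Fin f) (Fin m) ℝ}
    (hx : ∀ i j, |columnGram x i j - A i j| ≤ 16 * κ₂ * r) :
    (∃ V, IsScio (geminiA x) (C * M * r) V) ∧ ∀ V, IsScio (geminiA x) (C * M * r) V →
      specNorm (V - A⁻¹) ≤ (7 / 2 + (4 + κ₁ / 2 + 8 / κ₁) * (1 + κ₁ / 64)) * C ^ (1 - q) *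
        (s * M ^ (2 - 2 * q) * r ^ (1 - q)) := by
  have hM := hsparse.one_le_right hA hm
  have hs := hsparse.one_le_left hA hm hq0 hq1.le
  have hM0 : 0 < M := by linarith
  have hC0 : 0 < C := by linarith
  have : Nonempty (Fin m) := ⟨⟨0, hm⟩⟩
  have hS : ∀ i j, |geminiA x i j - A i j| ≤ 64 * κ₂ * r := by
    intro i j
    refine (abs_geminiA_sub_le hn hf hA ?_ hx i j).trans_eq (by ring)
    calc 16 * κ₂ * r ≤ 16 * κ₂ * (1 / (32 * κ₂)) := by gcongr
      _ = 1 / 2 := by field_simp; norm_num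
  have hMq : M ^ (-q) ≤ M ^ (2 - 2 * q) := Real.rpow_le_rpow_of_exponent_le hM (by linarith)
  have key := exists_isScio_and_specNorm_sub_inv_le (geminiA_isSymm x)
    (geminiA_dotProduct_mulVec_nonneg x) hA.1 hκ₁ hspec hS (lam := C * M * r) (by positivity)
    hq0 hq1 hsparse hM ?_ ?_
  · refine ⟨key.1, fun V hV => (key.2 V hV).trans_eq ?_⟩
    rw [show M * (C * M * r) = C * M ^ 2 * r by ring, Real.mul_rpow (by positivity) hr0.le,
      Real.mul_rpow hC0.le (by positivity), ← Real.rpow_natCast, ← Real.rpow_mul hM0.le]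
    rw [show ((2 : ℕ) : ℝ) * (1 - q) = 2 - 2 * q by push_cast; ring]
    ring
  · have : 64 * κ₂ * (M * r) ≤ C / 2 * (M * r) := by
      gcongr
      linarith
    linarith
  · calc 64 * κ₂ * r * (s * (C * M * r) ^ (-q))
        = 64 * κ₂ * C ^ (-q) * (s * M ^ (-q) * r ^ (1 - q)) := by
          rw [Real.mul_rpow (by positivity) hr0.le, Real.mul_rpow hC0.le hM0.le,
            show 1 - q = 1 + -q by ring, Real.rpow_add hr0, Real.rpow_one]
          ring
      _ ≤ 64 * κ₂ * C ^ (-q) * (s * M ^ (2 - 2 * q) * r ^ (1 - q)) := by gcongr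
      _ ≤ 64 * κ₂ * C ^ (-q) * (C ^ q * κ₁ / (64 * (64 * κ₂))) := by gcongr
      _ = κ₁ / 64 := by
          rw [Real.rpow_neg hC0.le]
          field_simp

lemma scioRate_eq {d : ℕ} (hm : 0 < m) :
    scioRate q s M m f n d = s * M ^ (2 - 2 * q) * √(logRatio m f n d) ^ (1 - q) := by
  have h0 : 0 ≤ logRatio m f n d := by
    refine div_nonneg (Real.log_nonneg ?_) (by positivity)
    exact_mod_cast hm.trans_le (le_max_left m f)
  rw [scioRate, Real.sqrt_eq_rpow, ← Real.rpow_mul h0]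
  congr 2
  ring

/-- Since s, M ≥ 1, the rate dominates r^(1-q); a vanishing rate thus forces r to be small. -/
lemma le_of_rate_le {r r₀ δ : ℝ} (hq1 : q < 1) (hs : 1 ≤ s) (hM : 1 ≤ M) (hr : 0 ≤ r)
    (hr₀ : 0 ≤ r₀) (h : s * M ^ (2 - 2 * q) * r ^ (1 - q) ≤ δ) (hδ : δ ≤ r₀ ^ (1 - q)) :
    r ≤ r₀ := by
  rw [← Real.rpow_le_rpow_iff hr hr₀ (sub_pos.mpr hq1)]
  refine le_trans ?_ (h.trans hδ)
  refine le_mul_of_one_le_left (by positivity) ?_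
  exact one_le_mul_of_one_le_of_one_le hs (Real.one_le_rpow hM (by linarith))

end Factor

/-! ### Combining the two factors -/

section Assembly

lemma scioKroneckerWithin_of_forall_le {n f m : ℕ} {A : Matrix (Fin m) (Fin m) ℝ}
    {B : Matrix (Fin f) (Fin f) ℝ} {lamA lamB κ a b c δA δB : ℝ}
    {x : Fin n → Matrix (Fin f) (Fin m) ℝ} (ha : 0 ≤ a) (hb : 0 ≤ b) (hκ : 0 < κ)
    (hδA : 0 ≤ δA) (hδB : 0 ≤ δB) (hδB1 : δB ≤ 1)
    (hAinv : specNorm A⁻¹ ≤ 1 / κ) (hBinv : specNorm B⁻¹ ≤ 1 / κ)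
    (hA : (∃ V, IsScio (geminiA x) lamA V) ∧
      ∀ V, IsScio (geminiA x) lamA V → specNorm (V - A⁻¹) ≤ a * δA)
    (hB : (∃ V, IsScio (geminiB x) lamB V) ∧
      ∀ V, IsScio (geminiB x) lamB V → specNorm (V - B⁻¹) ≤ b * δB)
    (hc : a * (1 / κ + b) + b / κ ≤ c) :
    ScioKroneckerWithin A B lamA lamB (c * (δA + δB)) x := by
  refine ⟨hA.1, hB.1, fun VA VB hVA hVB => ?_⟩
  rw [inv_kronecker]
  refine (specNorm_kronecker_sub_le _ _ _ _).trans ?_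
  have h1 := hA.2 VA hVA
  have h2 := hB.2 VB hVB
  calc _ ≤ a * δA * (1 / κ + b * δB) + 1 / κ * (b * δB) := by
        gcongr
        · exact add_nonneg (specNorm_nonneg _) (specNorm_nonneg _)
        · exact specNorm_nonneg _
    _ ≤ a * δA * (1 / κ + b * 1) + 1 / κ * (b * δB) := by gcongr
    _ = a * (1 / κ + b) * δA + b / κ * δB := by ring
    _ ≤ (a * (1 / κ + b) + b / κ) * δA + (a * (1 / κ + b) + b / κ) * δB := by
        gcongr
        · exact le_add_of_nonneg_right (by positivity)
        · exact le_add_of_nonneg_left (by positivity)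
    _ ≤ c * (δA + δB) := by
        rw [← mul_add]
        gcongr

lemma four_mul_sq_mul_exp_le {m N : ℕ} (hN : 0 < N) (h : m ≤ N) :
    4 * (m : ℝ) ^ 2 * Real.exp (-(4 * Real.log N)) ≤ 4 / (N : ℝ) ^ 2 := by
  have hN0 : (0 : ℝ) < N := by exact_mod_cast hN
  have hexp : Real.exp (-(4 * Real.log N)) = ((N : ℝ) ^ 4)⁻¹ := by
    rw [Real.exp_neg, ← Real.exp_log (pow_pos hN0 4), Real.log_pow]
    norm_num
  rw [hexp]
  calc 4 * (m : ℝ) ^ 2 * ((N : ℝ) ^ 4)⁻¹ ≤ 4 * (N : ℝ) ^ 2 * ((N : ℝ) ^ 4)⁻¹ := by gcongr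
    _ = _ := by field_simp

end Assembly

theorem corollary4 (q : ℝ) (hq0 : 0 ≤ q) (hq1 : q < 1)
    (κ₁ κ₂ : ℝ) (hκ₁ : 0 < κ₁) (hκ : κ₁ ≤ κ₂) :
    ∃ C₀ : ℝ, 0 < C₀ ∧ ∀ C_A C_B : ℝ, C₀ ≤ C_A → C₀ ≤ C_B →
    ∃ C D : ℝ, 0 < C ∧ 0 < D ∧
    ∀ (m f n : ℕ → ℕ) (A : ∀ k, Matrix (Fin (m k)) (Fin (m k)) ℝ)
      (B : ∀ k, Matrix (Fin (f k)) (Fin (f k)) ℝ) (sm Mm sf Mf : ℕ → ℝ)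
      (Ω : ℕ → Type*) [∀ k, MeasurableSpace (Ω k)]
      (P : ∀ k, Measure (Ω k)) [∀ k, IsProbabilityMeasure (P k)]
      (X : ∀ k, Fin (n k) → Ω k → Matrix (Fin (f k)) (Fin (m k)) ℝ),
      (∀ k, 0 < m k ∧ 0 < f k ∧ 0 < n k) →
      (∀ k, IsCorrelation (A k) ∧ IsCorrelation (B k)) →
      (∀ k, (∀ μ ∈ spectrum ℝ (A k), κ₁ ≤ μ ∧ μ ≤ κ₂) ∧
        (∀ μ ∈ spectrum ℝ (B k), κ₁ ≤ μ ∧ μ ≤ κ₂)) →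
      (∀ k, SparseClass q (sm k) (Mm k) (A k)⁻¹ ∧ SparseClass q (sf k) (Mf k) (B k)⁻¹) →
      Tendsto (fun k => scioRate q (sm k) (Mm k) (m k) (f k) (n k) (f k)) atTop (𝓝 0) →
      Tendsto (fun k => scioRate q (sf k) (Mf k) (m k) (f k) (n k) (m k)) atTop (𝓝 0) →
      (∀ k, IsMatrixNormalSample (P k) (A k) (B k) (X k)) →
      ∀ᶠ k in atTop,
        P k {ω | ¬ ScioKroneckerWithin (A k) (B k)
            (C_A * Mm k * √(logRatio (m k) (f k) (n k) (f k)))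
            (C_B * Mf k * √(logRatio (m k) (f k) (n k) (m k)))
            (C * (scioRate q (sm k) (Mm k) (m k) (f k) (n k) (f k) +
              scioRate q (sf k) (Mf k) (m k) (f k) (n k) (m k)))
            (fun t => X k t ω)} ≤
          ENNReal.ofReal (D / ((max (m k) (f k) : ℕ) : ℝ) ^ 2) := by
  have hκ₂ : 0 < κ₂ := hκ₁.trans_le hκ
  -- The pilot error is ρ = 64κ₂r, so this is what ρM ≤ λ/2 demands.
  refine ⟨128 * κ₂, by positivity, fun C_A C_B hCA hCB => ?_⟩
  have hCA0 : 0 < C_A := by linarith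
  have hCB0 : 0 < C_B := by linarith
  set c₀ := 7 / 2 + (4 + κ₁ / 2 + 8 / κ₁) * (1 + κ₁ / 64) with hc₀
  have hc₀0 : 0 < c₀ := by positivity
  set a := c₀ * C_A ^ (1 - q) with ha
  set b := c₀ * C_B ^ (1 - q) with hb
  have ha0 : 0 < a := by positivity
  have hb0 : 0 < b := by positivity
  refine ⟨a * (1 / κ₁ + b) + b / κ₁, 8, by positivity, by norm_num, ?_⟩
  intro m f n A B sm Mm sf Mf Ω _ P _ X hpos hcorr hspec hsparse hδA hδB hX
  set r₀ := min (1 / 8) (1 / (32 * κ₂)) with hr₀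
  have hr₀0 : 0 < r₀ := by positivity
  -- The four bounds serve, in turn, r ≤ r₀ (valid Chernoff range and Gram error at most 1/2), δ_B ≤
  -- 1 in the cross term, and ρsλ^(-q) ≤ κ₁/64 for each factor.
  set ε := min (r₀ ^ (1 - q)) (min 1 (min (C_A ^ q * κ₁ / (64 * (64 * κ₂)))
    (C_B ^ q * κ₁ / (64 * (64 * κ₂))))) with hε
  have hε0 : 0 < ε := by positivity
  filter_upwards [hδA.eventually_lt_const hε0, hδB.eventually_lt_const hε0] with k hkA hkB
  obtain ⟨hm, hf, hn⟩ := hpos k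
  obtain ⟨hA, hB⟩ := hcorr k
  obtain ⟨hspA, hspB⟩ := hspec k
  obtain ⟨hsA, hsB⟩ := hsparse k
  have hsample := (hX k).isKroneckerSample hA.1.posSemidef hB.1.posSemidef
  set N := max (m k) (f k) with hN
  have hN0 : 0 < N := hm.trans_le (le_max_left _ _)
  -- For m = f = 1 the logarithm and both penalties vanish, but the claimed bound 8/N² exceeds 1.
  rcases Nat.lt_or_ge N 2 with hN2 | hN2
  · have : N = 1 := by omega
    rw [this]
    refine prob_le_one.trans ?_
    rw [← ENNReal.ofReal_one]
    exact ENNReal.ofReal_le_ofReal (by norm_num)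
  have hL : 0 < Real.log N := Real.log_pos (by exact_mod_cast hN2)
  have hε1 : ε ≤ r₀ ^ (1 - q) := min_le_left _ _
  have hε2 : ε ≤ 1 := (min_le_right _ _).trans (min_le_left _ _)
  have hεA : ε ≤ C_A ^ q * κ₁ / (64 * (64 * κ₂)) :=
    (min_le_right _ _).trans ((min_le_right _ _).trans (min_le_left _ _))
  have hεB : ε ≤ C_B ^ q * κ₁ / (64 * (64 * κ₂)) :=
    (min_le_right _ _).trans ((min_le_right _ _).trans (min_le_right _ _))
  have hr₀1 : r₀ ≤ 1 / 8 := min_le_left _ _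
  have hr₀2 : r₀ ≤ 1 / (32 * κ₂) := min_le_right _ _
  set rA := √(logRatio (m k) (f k) (n k) (f k)) with hrA
  set rB := √(logRatio (m k) (f k) (n k) (m k)) with hrB
  have hlA : 0 < logRatio (m k) (f k) (n k) (f k) := by unfold logRatio; positivity
  have hlB : 0 < logRatio (m k) (f k) (n k) (m k) := by unfold logRatio; positivity
  have hrA0 : 0 < rA := Real.sqrt_pos.mpr hlA
  have hrB0 : 0 < rB := Real.sqrt_pos.mpr hlB
  have hrAL : n k * f k * rA ^ 2 = Real.log N := by
    rw [hrA, Real.sq_sqrt hlA.le, logRatio, ← hN]; field_simp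
  have hrBL : n k * m k * rB ^ 2 = Real.log N := by
    rw [hrB, Real.sq_sqrt hlB.le, logRatio, ← hN]; field_simp
  have hMA := hsA.one_le_right hA hm
  have hMB := hsB.one_le_right hB hf
  have hsA1 := hsA.one_le_left hA hm hq0 hq1.le
  have hsB1 := hsB.one_le_left hB hf hq0 hq1.le
  rw [scioRate_eq hm] at hkA hkB ⊢
  rw [scioRate_eq hm]
  have hrA1 := le_of_rate_le hq1 hsA1 hMA hrA0.le hr₀0.le hkA.le hε1
  have hrB1 := le_of_rate_le hq1 hsB1 hMB hrB0.le hr₀0.le hkB.le hε1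
  have tA := hsample.columnGram_tail hA hB hκ₂ (fun μ hμ => (hspB μ hμ).2) hn hf hrA0.le
    (hrA1.trans hr₀1) hrAL
  have tB := hsample.transpose.columnGram_tail hB hA hκ₂ (fun μ hμ => (hspA μ hμ).2) hn hm hrB0.le
    (hrB1.trans hr₀1) hrBL
  have tA' := tA.trans (four_mul_sq_mul_exp_le hN0 (le_max_left _ _))
  have tB' := tB.trans (four_mul_sq_mul_exp_le hN0 (le_max_right _ _))
  rw [measureReal_def] at tA' tB'
  set EA := {ω | ∃ i j, 16 * κ₂ * rA < |columnGram (fun t => X k t ω) i j - A k i j|}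
  set EB := {ω | ∃ i j, 16 * κ₂ * rB < |columnGram (fun t => (X k t ω)ᵀ) i j - B k i j|}
  calc _ ≤ P k (EA ∪ EB) := by
        refine measure_mono fun ω hω => ?_
        by_contra hcon
        rw [Set.mem_union, not_or, Set.mem_ofPred_eq, Set.mem_ofPred_eq] at hcon
        rw [Set.mem_ofPred_eq] at hω
        refine hω ?_
        obtain ⟨h1, h2⟩ := hcon
        push Not at h1 h2
        exact scioKroneckerWithin_of_forall_le ha0.le hb0.le hκ₁ (by positivity) (by positivity)
          (hkB.le.trans hε2) (specNorm_inv_le hA.1 hκ₁ fun μ hμ => (hspA μ hμ).1)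
          (specNorm_inv_le hB.1 hκ₁ fun μ hμ => (hspB μ hμ).1)
          (exists_isScio_geminiA_and_specNorm_sub_inv_le hn hf hm hA hκ₁ hκ₂
            (fun μ hμ => (hspA μ hμ).1) hq0 hq1 hsA hCA hrA0 (hrA1.trans hr₀2)
            (hkA.le.trans hεA) h1)
          (exists_isScio_geminiA_and_specNorm_sub_inv_le hn hm hf hB hκ₁ hκ₂
            (fun μ hμ => (hspB μ hμ).1) hq0 hq1 hsB hCB hrB0 (hrB1.trans hr₀2)
            (hkB.le.trans hεB) h2) le_rfl
    _ ≤ P k EA + P k EB := measure_union_le _ _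
    _ ≤ ENNReal.ofReal (4 / (N : ℝ) ^ 2) + ENNReal.ofReal (4 / (N : ℝ) ^ 2) := by
        gcongr
        · exact (ENNReal.le_ofReal_iff_toReal_le (measure_ne_top _ _) (by positivity)).mpr tA'
        · exact (ENNReal.le_ofReal_iff_toReal_le (measure_ne_top _ _) (by positivity)).mpr tB'
    _ = ENNReal.ofReal (8 / (N : ℝ) ^ 2) := by
        rw [← ENNReal.ofReal_add (by positivity) (by positivity)]
        congr 1
        ring
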